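/- Let $M$ be a compact Kähler manifold, with Kähler metric regarded as a Hermitian metric $g$ on its holomorphic tangent bundle. Let $\mathbb C^n$ carry its standard Hermitian inner product, and let $Gr_p(\mathbb C^n)$ be the complex manifold of $p$-dimensional subspaces of $\mathbb C^n$. Let $S$ be its tautological bundle and $Q=\underline{\mathbb C^n}/S$ its universal quotient bundle, of rank $q=n-p$, with the Hermitian metric $h_Q$ induced by the smooth isomorphism $Q\cong S^\perp\subset\underline{\mathbb C^n}$. Equip $Gr_p(\mathbb C^n)$ with the Hermitian metric of Fubini–Study type $h_{Gr}=h_{S^*}\otimes h_Q$ on its holomorphic tangent bundle $S^*\otimes Q$. Let $f:M\to Gr_p(\mathbb C^n)$ be a holomorphic map which is isometric, i.e. $f^*h_{Gr}=g$. Then the following are equivalent. (1) $f$ is strongly projectively flat: there is a holomorphic Hermitian line bundle $L\to M$ such that $f^*Q$, with the pulled back holomorphic structure and the pulled back metric, is isomorphic, as a holomorphic vector bundle with fibre metric, to the orthogonal direct sum of $q$ copies of $L$. (2) $f$ is projectively flat: the curvature of the Chern connection of the holomorphic Hermitian vector bundle $f^*Q$ is of the form $R^{f^*Q}=\alpha\,\mathrm{Id}$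 for some complex-valued $2$-form $\alpha$ on $M$. -/

import Mathlib

open scoped Manifold ContDiff Bundle Topology
open Bundle Set

noncomputable section

namespace ProjFlat

/-- The Hermitian vector space `ℂⁿ`. -/
abbrev Cn (n : ℕ) : Type := EuclideanSpace ℂ (Fin n)

/-- The Grassmannian of complex `p`-planes in `ℂⁿ`. -/
@[ext]
structure Gr (p n : ℕ) : Type where
  /-- the plane -/
  carrier : Submodule ℂ (Cn n)
  finrank_carrier : Module.finrank ℂ carrier = p

/-- The model space `Hom(ℂᵖ, ℂ^{n-p})` of the Grassmannian. -/
abbrev GrModel (p n : ℕ) : Type := Cn p →L[ℂ] Cn (n - p)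

namespace Gr

variable {p n : ℕ}

lemma finrank_orthogonal (U : Gr p n) : Module.finrank ℂ (U.1ᗮ : Submodule ℂ (Cn n)) = n - p := by
  have h := U.1.finrank_add_finrank_orthogonal
  rw [U.2, finrank_euclideanSpace_fin] at h
  omega

/-- A (chosen) isometry `U ≅ ℂᵖ`. -/
def isoSub (U : Gr p n) : U.1 ≃ₗᵢ[ℂ] Cn p :=
  ((stdOrthonormalBasis ℂ U.1).reindex (finCongr U.2)).repr

/-- A (chosen) isometry `Uᗮ ≅ ℂ^{n-p}`. -/
def isoPerp (U : Gr p n) : (U.1ᗮ : Submodule ℂ (Cn n)) ≃ₗᵢ[ℂ] Cn (n - p) :=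
  ((stdOrthonormalBasis ℂ (U.1ᗮ : Submodule ℂ (Cn n))).reindex (finCongr U.finrank_orthogonal)).repr

/-- The isometric embedding `ℂᵖ ≅ U ⊆ ℂⁿ`. -/
def inclSub (U : Gr p n) : Cn p →L[ℂ] Cn n :=
  U.1.subtypeL ∘L (U.isoSub.symm.toContinuousLinearEquiv : Cn p →L[ℂ] U.1)

/-- The isometric embedding `ℂ^{n-p} ≅ Uᗮ ⊆ ℂⁿ`. -/
def inclPerp (U : Gr p n) : Cn (n - p) →L[ℂ] Cn n :=
  (U.1ᗮ).subtypeL ∘L (U.isoPerp.symm.toContinuousLinearEquiv : Cn (n - p) →L[ℂ] _)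

/-- The orthogonal projection `ℂⁿ → U ≅ ℂᵖ`. -/
def coordSub (U : Gr p n) : Cn n →L[ℂ] Cn p :=
  (U.isoSub.toContinuousLinearEquiv : U.1 →L[ℂ] Cn p) ∘L U.1.orthogonalProjectionOnto

/-- The orthogonal projection `ℂⁿ → Uᗮ ≅ ℂ^{n-p}`. -/
def coordPerp (U : Gr p n) : Cn n →L[ℂ] Cn (n - p) :=
  (U.isoPerp.toContinuousLinearEquiv : _ →L[ℂ] Cn (n - p)) ∘L (U.1ᗮ).orthogonalProjectionOnto

@[simp] lemma coordSub_inclSub (U : Gr p n) (v : Cn p) : U.coordSub (U.inclSub v) = v := by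
  simp [coordSub, inclSub]

@[simp] lemma coordPerp_inclPerp (U : Gr p n) (v : Cn (n - p)) :
    U.coordPerp (U.inclPerp v) = v := by
  simp [coordPerp, inclPerp]

@[simp] lemma coordSub_inclPerp (U : Gr p n) (v : Cn (n - p)) :
    U.coordSub (U.inclPerp v) = 0 := by
  have : U.1.orthogonalProjectionOnto (U.inclPerp v) = 0 :=
    Submodule.orthogonalProjectionOnto_apply_of_mem_orthogonal (by simp [inclPerp])
  simp [coordSub, this]

@[simp] lemma coordPerp_inclSub (U : Gr p n) (v : Cn p) : U.coordPerp (U.inclSub v) = 0 := by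
  have : (U.1ᗮ).orthogonalProjectionOnto (U.inclSub v) = 0 :=
    Submodule.orthogonalProjectionOnto_apply_of_mem_orthogonal
      (by simp [inclSub])
  simp [coordPerp, this]

lemma decomp (U : Gr p n) (v : Cn n) :
    U.inclSub (U.coordSub v) + U.inclPerp (U.coordPerp v) = v := by
  simp [inclSub, inclPerp, coordSub, coordPerp]

lemma inclSub_mem (U : Gr p n) (v : Cn p) : U.inclSub v ∈ U.1 := by simp [inclSub]

lemma inclSub_coordSub (U : Gr p n) {v : Cn n} (hv : v ∈ U.1) :
    U.inclSub (U.coordSub v) = v := by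
  simp [inclSub, coordSub, Submodule.starProjection_eq_self_iff.2 hv]

lemma range_inclSub (U : Gr p n) : LinearMap.range (U.inclSub : Cn p →ₗ[ℂ] Cn n) = U.1 := by
  ext v
  constructor
  · rintro ⟨w, rfl⟩; exact U.inclSub_mem w
  · intro hv; exact ⟨_, U.inclSub_coordSub hv⟩

/-- The domain of the graph chart centred at `U`: the planes `W` which project isomorphically
onto `U`. -/
def dom (U : Gr p n) : Set (Gr p n) := {W | (U.coordSub ∘L W.inclSub).IsInvertible}

/-- The graph coordinate: `W` is the graph of this linear map `ℂᵖ ≅ U → Uᗮ ≅ ℂ^{n-p}`. -/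
def slope (U W : Gr p n) : GrModel p n :=
  (U.coordPerp ∘L W.inclSub) ∘L (U.coordSub ∘L W.inclSub).inverse

/-- The plane `{u + A u | u ∈ U}`, the graph of `A`. -/
def graph (U : Gr p n) (A : GrModel p n) : Gr p n :=
  ⟨LinearMap.range ((U.inclSub + U.inclPerp ∘L A : Cn p →L[ℂ] Cn n) : Cn p →ₗ[ℂ] Cn n), by
    rw [LinearMap.finrank_range_of_inj, finrank_euclideanSpace_fin]
    intro v w h
    simpa using congrArg U.coordSub h⟩

/-- `slope` and `dom` can be computed using any parametrization of `W`. -/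
lemma param_aux (W : Gr p n) (j : Cn p →L[ℂ] Cn n)
    (hj : LinearMap.range (j : Cn p →ₗ[ℂ] Cn n) = W.1) :
    ∃ g : Cn p ≃L[ℂ] Cn p, j = W.inclSub ∘L (g : Cn p →L[ℂ] Cn p) := by
  have hmem : ∀ v, j v ∈ W.1 := fun v => hj ▸ LinearMap.mem_range_self (j : Cn p →ₗ[ℂ] Cn n) v
  have hinj : Function.Injective (j : Cn p →ₗ[ℂ] Cn n) := by
    rw [← LinearMap.ker_eq_bot, ← Submodule.finrank_eq_zero (R := ℂ)]
    have := LinearMap.finrank_range_add_finrank_ker (j : Cn p →ₗ[ℂ] Cn n)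
    rw [hj, W.2, finrank_euclideanSpace_fin] at this
    omega
  let g₀ : Cn p →ₗ[ℂ] Cn p := ((W.coordSub ∘L j : Cn p →L[ℂ] Cn p) : Cn p →ₗ[ℂ] Cn p)
  have hg₀ : Function.Injective g₀ := by
    intro v w h
    apply hinj
    have h' := congrArg W.inclSub (show W.coordSub (j v) = W.coordSub (j w) from h)
    rwa [W.inclSub_coordSub (hmem v), W.inclSub_coordSub (hmem w)] at h'
  refine ⟨(LinearEquiv.ofInjectiveEndo g₀ hg₀).toContinuousLinearEquiv, ?_⟩
  ext1 v
  exact (W.inclSub_coordSub (hmem v)).symm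

lemma mem_dom_iff (U W : Gr p n) (j : Cn p →L[ℂ] Cn n)
    (hj : LinearMap.range (j : Cn p →ₗ[ℂ] Cn n) = W.1) :
    W ∈ U.dom ↔ (U.coordSub ∘L j).IsInvertible := by
  obtain ⟨g, rfl⟩ := param_aux W j hj
  rw [← ContinuousLinearMap.comp_assoc, ContinuousLinearMap.isInvertible_comp_equiv]
  rfl

lemma slope_eq (U W : Gr p n) (j : Cn p →L[ℂ] Cn n)
    (hj : LinearMap.range (j : Cn p →ₗ[ℂ] Cn n) = W.1) :
    U.slope W = (U.coordPerp ∘L j) ∘L (U.coordSub ∘L j).inverse := by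
  obtain ⟨g, rfl⟩ := param_aux W j hj
  rw [← ContinuousLinearMap.comp_assoc, ← ContinuousLinearMap.comp_assoc,
    ContinuousLinearMap.inverse_comp_equiv]
  ext1 v
  simp [slope]

lemma slope_graph (U : Gr p n) (A : GrModel p n) : U.slope (U.graph A) = A := by
  rw [slope_eq U (U.graph A) (U.inclSub + U.inclPerp ∘L A) rfl]
  have h1 : U.coordSub ∘L (U.inclSub + U.inclPerp ∘L A) = .id ℂ _ := by ext1 v; simp
  have h2 : U.coordPerp ∘L (U.inclSub + U.inclPerp ∘L A) = A := by ext1 v; simp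
  rw [h1, h2]
  simp

lemma graph_mem_dom (U : Gr p n) (A : GrModel p n) : U.graph A ∈ U.dom := by
  rw [mem_dom_iff U (U.graph A) (U.inclSub + U.inclPerp ∘L A) rfl]
  have h1 : U.coordSub ∘L (U.inclSub + U.inclPerp ∘L A) = .id ℂ _ := by ext1 v; simp
  rw [h1]
  exact ContinuousLinearMap.isInvertible_equiv (f := ContinuousLinearEquiv.refl ℂ _)

lemma slope_coordSub (U : Gr p n) {W : Gr p n} (hW : W ∈ U.dom) {v : Cn n} (hv : v ∈ W.1) :
    U.slope W (U.coordSub v) = U.coordPerp v := by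
  rw [← W.inclSub_coordSub hv]
  have h : (U.coordSub ∘L W.inclSub).IsInvertible := hW
  have := h.inverse_apply_self (W.coordSub v)
  simp only [ContinuousLinearMap.comp_apply] at this
  simp [slope, this]

lemma mem_of_slope (U : Gr p n) {W : Gr p n} (hW : W ∈ U.dom) {v : Cn n}
    (hv : U.slope W (U.coordSub v) = U.coordPerp v) : v ∈ W.1 := by
  have h : (U.coordSub ∘L W.inclSub).IsInvertible := hW
  obtain ⟨w, hw⟩ := h.surjective (U.coordSub v)
  have hw' : U.coordSub (W.inclSub w) = U.coordSub v := hw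
  have h2 := U.slope_coordSub hW (W.inclSub_mem w)
  rw [hw', hv] at h2
  rw [← U.decomp v, ← hw', h2, U.decomp]
  exact W.inclSub_mem w

lemma graph_slope (U : Gr p n) {W : Gr p n} (hW : W ∈ U.dom) : U.graph (U.slope W) = W := by
  apply Gr.ext
  apply Submodule.eq_of_le_of_finrank_eq
  · rintro _ ⟨v, rfl⟩
    apply U.mem_of_slope hW
    simp
  · rw [(U.graph _).2, W.2]

/-- The graph chart of the Grassmannian centred at `U`. -/
def chart (U : Gr p n) : PartialEquiv (Gr p n) (GrModel p n) where
  toFun := U.slope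
  invFun := U.graph
  source := U.dom
  target := univ
  map_source' _ _ := mem_univ _
  map_target' A _ := U.graph_mem_dom A
  left_inv' _ hW := U.graph_slope hW
  right_inv' A _ := U.slope_graph A

lemma mem_dom_self (U : Gr p n) : U ∈ U.dom := by
  have h1 : U.coordSub ∘L U.inclSub = .id ℂ _ := by ext1 v; simp
  simp only [dom, mem_ofPred_eq, h1]
  exact ContinuousLinearMap.isInvertible_equiv (f := ContinuousLinearEquiv.refl ℂ _)

lemma isOpen_isInvertible : IsOpen {X : Cn p →L[ℂ] Cn p | X.IsInvertible} := by
  have : {X : Cn p →L[ℂ] Cn p | X.IsInvertible} = range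
      ((↑) : (Cn p ≃L[ℂ] Cn p) → (Cn p →L[ℂ] Cn p)) := rfl
  rw [this]
  exact ContinuousLinearEquiv.isOpen

lemma source_trans (U V : Gr p n) : (U.chart.symm.trans V.chart).source =
    (fun A : GrModel p n => V.coordSub ∘L (U.inclSub + U.inclPerp ∘L A)) ⁻¹'
      {X : Cn p →L[ℂ] Cn p | X.IsInvertible} := by
  ext A
  simp only [PartialEquiv.trans_source, chart, PartialEquiv.symm_source, univ_inter,
    mem_preimage, mem_ofPred_eq, PartialEquiv.coe_symm_mk]
  exact mem_dom_iff V (U.graph A) _ rfl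

lemma isOpen_source_trans (U V : Gr p n) : IsOpen (U.chart.symm.trans V.chart).source := by
  rw [source_trans]
  exact isOpen_isInvertible.preimage (by fun_prop)

lemma contDiffOn_trans (U V : Gr p n) : ContDiffOn ℂ ω (U.chart.symm.trans V.chart)
    (U.chart.symm.trans V.chart).source := by
  have key : ∀ A : GrModel p n, (U.chart.symm.trans V.chart) A =
      (V.coordPerp ∘L (U.inclSub + U.inclPerp ∘L A)) ∘L
        (V.coordSub ∘L (U.inclSub + U.inclPerp ∘L A)).inverse :=
    fun A => slope_eq V (U.graph A) _ rfl
  rw [source_trans]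
  intro A hA
  refine ContDiffAt.contDiffWithinAt ?_
  have hlin : ∀ {k : ℕ} (T : Cn n →L[ℂ] Cn k), ContDiff ℂ ω
      (fun A : GrModel p n => T ∘L (U.inclSub + U.inclPerp ∘L A)) := fun T =>
    contDiff_const.clm_comp (contDiff_const.add (contDiff_const.clm_comp contDiff_id))
  have hinv : ContDiffAt ℂ ω (fun A : GrModel p n =>
      (V.coordSub ∘L (U.inclSub + U.inclPerp ∘L A)).inverse) A :=
    ContDiffAt.comp (g := ContinuousLinearMap.inverse) A
      (ContinuousLinearMap.IsInvertible.contDiffAt_map_inverse hA) (hlin V.coordSub).contDiffAt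
  exact ((hlin V.coordPerp).contDiffAt.clm_comp hinv).congr_of_eventuallyEq
    (Filter.Eventually.of_forall key)

variable (p n) in
/-- The standard atlas of graph charts. -/
def core : ChartedSpaceCore (GrModel p n) (Gr p n) where
  atlas := range chart
  chartAt := chart
  mem_chart_source := mem_dom_self
  chart_mem_atlas U := ⟨U, rfl⟩
  open_source := by
    rintro _ _ ⟨U, rfl⟩ ⟨V, rfl⟩
    exact isOpen_source_trans U V
  continuousOn_toFun := by
    rintro _ _ ⟨U, rfl⟩ ⟨V, rfl⟩
    exact (contDiffOn_trans U V).continuousOn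

instance : TopologicalSpace (Gr p n) := (core p n).toTopologicalSpace

instance : ChartedSpace (GrModel p n) (Gr p n) := (core p n).toChartedSpace

/-- The Grassmannian is a complex manifold. -/
instance : IsManifold 𝓘(ℂ, GrModel p n) ω (Gr p n) := by
  apply isManifold_of_contDiffOn
  intro e e' he he'
  simp only [atlas, ChartedSpace.atlas, mem_iUnion, mem_singleton_iff] at he he'
  obtain ⟨_, ⟨U, rfl⟩, rfl⟩ := he
  obtain ⟨_, ⟨V, rfl⟩, rfl⟩ := he'
  simp only [modelWithCornersSelf_coe, modelWithCornersSelf_coe_symm, Function.id_comp,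
    Function.comp_id, preimage_id, range_id, inter_univ]
  exact contDiffOn_trans U V

lemma chartAt_apply (U W : Gr p n) : chartAt (GrModel p n) U W = U.slope W := rfl

lemma chartAt_source (U : Gr p n) : (chartAt (GrModel p n) U).source = U.dom := rfl

lemma contMDiffOn_slope (U : Gr p n) :
    ContMDiffOn 𝓘(ℂ, GrModel p n) 𝓘(ℂ, GrModel p n) ω U.slope U.dom :=
  contMDiffOn_chart (x := U)


/-- The fibre `ℂⁿ / U` of the universal quotient bundle at `U`. -/
def QFib (U : Gr p n) : Type := Cn n ⧸ U.1

instance (U : Gr p n) : AddCommGroup U.QFib := inferInstanceAs (AddCommGroup (Cn n ⧸ U.1))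
instance (U : Gr p n) : Module ℂ U.QFib := inferInstanceAs (Module ℂ (Cn n ⧸ U.1))
instance (U : Gr p n) : TopologicalSpace U.QFib := inferInstanceAs (TopologicalSpace (Cn n ⧸ U.1))

/-- The identification of the fibre of the universal quotient bundle with `ℂⁿ / U`. -/
def quotEquiv (U : Gr p n) : U.QFib ≃ₗ[ℂ] (Cn n ⧸ U.1) := LinearEquiv.refl ℂ _

/-- The projection `ℂⁿ → ℂⁿ / U`. -/
def toQuot (U : Gr p n) : Cn n →ₗ[ℂ] U.QFib := U.1.mkQ

lemma toQuot_surjective (U : Gr p n) : Function.Surjective U.toQuot := U.1.mkQ_surjective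

lemma toQuot_eq_zero (U : Gr p n) {v : Cn n} : U.toQuot v = 0 ↔ v ∈ U.1 :=
  Submodule.Quotient.mk_eq_zero U.1

open Classical in
/-- Over the chart domain of `U`, the coordinate `v mod W ↦ v_{Uᗮ} - A v_U` of `ℂⁿ / W`, where
`W` is the graph of `A : U → Uᗮ`. -/
def quotCoord (U W : Gr p n) : W.QFib →ₗ[ℂ] Cn (n - p) :=
  if hW : W ∈ U.dom then
    (W.1.liftQ ((U.coordPerp - U.slope W ∘L U.coordSub : Cn n →L[ℂ] Cn (n - p)) :
      Cn n →ₗ[ℂ] Cn (n - p)) (fun v hv => by simp [U.slope_coordSub hW hv])) ∘ₗ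
      (W.quotEquiv : W.QFib →ₗ[ℂ] (Cn n ⧸ W.1))
  else 0

lemma quotCoord_toQuot (U : Gr p n) {W : Gr p n} (hW : W ∈ U.dom) (v : Cn n) :
    U.quotCoord W (W.toQuot v) = U.coordPerp v - U.slope W (U.coordSub v) := by
  rw [quotCoord, dif_pos hW]
  rfl

lemma quotCoord_injective (U : Gr p n) {W : Gr p n} (hW : W ∈ U.dom) :
    Function.Injective (U.quotCoord W) := by
  rw [injective_iff_map_eq_zero]
  intro x hx
  obtain ⟨v, rfl⟩ := W.toQuot_surjective x
  rw [quotCoord_toQuot U hW, sub_eq_zero] at hx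
  exact W.toQuot_eq_zero.2 (U.mem_of_slope hW hx.symm)

lemma quotCoord_inclPerp (U : Gr p n) {W : Gr p n} (hW : W ∈ U.dom) (c : Cn (n - p)) :
    U.quotCoord W (W.toQuot (U.inclPerp c)) = c := by
  simp [quotCoord_toQuot U hW]

lemma isOpen_dom (U : Gr p n) : IsOpen U.dom := (chartAt (GrModel p n) U).open_source

/-- The trivialization of the universal quotient bundle over a chart domain. -/
def quotTriv (U : Gr p n) : Pretrivialization (Cn (n - p)) (π (Cn (n - p)) (QFib (p := p) (n := n)))
    where
  toFun x := (x.1, U.quotCoord x.1 x.2)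
  invFun y := ⟨y.1, y.1.toQuot (U.inclPerp y.2)⟩
  source := TotalSpace.proj ⁻¹' U.dom
  target := U.dom ×ˢ univ
  map_source' _ hx := ⟨hx, mem_univ _⟩
  map_target' _ hy := hy.1
  left_inv' := by
    rintro ⟨W, x⟩ hW
    have hW : W ∈ U.dom := hW
    simp only
    congr 1
    exact U.quotCoord_injective hW (U.quotCoord_inclPerp hW _)
  right_inv' := by
    rintro ⟨W, c⟩ ⟨hW, -⟩
    simp only [U.quotCoord_inclPerp hW]
  open_target := U.isOpen_dom.prod isOpen_univ
  baseSet := U.dom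
  open_baseSet := U.isOpen_dom
  source_eq := rfl
  target_eq := rfl
  proj_toFun _ _ := rfl

instance quotTriv_linear (U : Gr p n) : (quotTriv U).IsLinear ℂ where
  linear W _ := ⟨(U.quotCoord W).map_add, (U.quotCoord W).map_smul⟩

/-- The transition functions of the universal quotient bundle. -/
def quotTrans (U V W : Gr p n) : Cn (n - p) →L[ℂ] Cn (n - p) :=
  (V.coordPerp - V.slope W ∘L V.coordSub) ∘L U.inclPerp

lemma contMDiffOn_quotTrans (U V : Gr p n) :
    ContMDiffOn 𝓘(ℂ, GrModel p n) 𝓘(ℂ, Cn (n - p) →L[ℂ] Cn (n - p)) ω (quotTrans U V) V.dom := by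
  have h : ContDiff ℂ ω (fun A : GrModel p n =>
      (V.coordPerp - A ∘L V.coordSub) ∘L U.inclPerp) :=
    (contDiff_const.sub (contDiff_id.clm_comp contDiff_const)).clm_comp contDiff_const
  exact h.contMDiff.comp_contMDiffOn V.contMDiffOn_slope

lemma quotTrans_apply (U V : Gr p n) {W : Gr p n} (hU : W ∈ U.dom) (hV : W ∈ V.dom)
    (c : Cn (n - p)) : quotTrans U V W c = (quotTriv V ⟨W, (quotTriv U).symm W c⟩).2 := by
  have h : (quotTriv U).symm W c = W.toQuot (U.inclPerp c) := by
    rw [Pretrivialization.symm_apply _ (show W ∈ (quotTriv U).baseSet from hU)]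
    rfl
  rw [h]
  change _ = V.quotCoord W _
  rw [quotCoord_toQuot V hV]
  rfl

variable (p n) in
/-- The universal quotient bundle, glued from its trivializations. -/
def quotPrebundle : VectorPrebundle ℂ (Cn (n - p)) (QFib (p := p) (n := n)) where
  pretrivializationAtlas := range quotTriv
  pretrivialization_linear' := by
    rintro _ ⟨U, rfl⟩
    exact quotTriv_linear U
  pretrivializationAt := quotTriv
  mem_base_pretrivializationAt := mem_dom_self
  pretrivialization_mem_atlas U := ⟨U, rfl⟩
  exists_coordChange := by
    rintro _ ⟨U, rfl⟩ _ ⟨V, rfl⟩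
    exact ⟨quotTrans U V, (contMDiffOn_quotTrans U V).continuousOn.mono inter_subset_right,
      fun W hW c => quotTrans_apply U V hW.1 hW.2 c⟩
  totalSpaceMk_isInducing W := by
    have : IsClosed (W.1 : Set (Cn n)) := W.1.closed_of_finiteDimensional
    let g : (Cn n ⧸ W.1) →ₗ[ℂ] Cn (n - p) := W.quotCoord W
    have hg : Topology.IsInducing g :=
      (LinearMap.isClosedEmbedding_of_injective (f := g)
        (LinearMap.ker_eq_bot.2 (W.quotCoord_injective W.mem_dom_self))).isInducing
    have h2 : Topology.IsInducing (fun c : Cn (n - p) => (W, c)) := isInducing_prodMkRight W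
    exact h2.comp hg

instance : TopologicalSpace (TotalSpace (Cn (n - p)) (QFib (p := p) (n := n))) :=
  (quotPrebundle p n).totalSpaceTopology

instance : FiberBundle (Cn (n - p)) (QFib (p := p) (n := n)) := (quotPrebundle p n).toFiberBundle

instance : VectorBundle ℂ (Cn (n - p)) (QFib (p := p) (n := n)) := (quotPrebundle p n).toVectorBundle

instance : (quotPrebundle p n).IsContMDiff 𝓘(ℂ, GrModel p n) ω where
  exists_contMDiffCoordChange := by
    rintro _ ⟨U, rfl⟩ _ ⟨V, rfl⟩
    exact ⟨quotTrans U V, (contMDiffOn_quotTrans U V).mono inter_subset_right,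
      fun W hW c => quotTrans_apply U V hW.1 hW.2 c⟩

/-- The universal quotient bundle is a holomorphic vector bundle. -/
instance : ContMDiffVectorBundle ω (Cn (n - p)) (QFib (p := p) (n := n)) 𝓘(ℂ, GrModel p n) :=
  (quotPrebundle p n).contMDiffVectorBundle 𝓘(ℂ, GrModel p n)

end Gr

/-! ### Holomorphic vector bundles with Hermitian metrics -/

section Bundles

variable {E : Type*} [NormedAddCommGroup E] [NormedSpace ℂ E]
  {M : Type*} [TopologicalSpace M] [ChartedSpace E M]

section Sums

variable (F : Type*) [NormedAddCommGroup F] [NormedSpace ℂ F]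
  (V : M → Type*) [∀ x, AddCommGroup (V x)] [∀ x, Module ℂ (V x)]
  [∀ x, TopologicalSpace (V x)] [TopologicalSpace (TotalSpace F V)] [FiberBundle F V]
  [VectorBundle ℂ F V]

/-- The fibre of the direct sum `V ⊕ ⋯ ⊕ V` of `r` copies of a vector bundle `V`. -/
def Copies (r : ℕ) (V : M → Type*) (x : M) : Type _ := Fin r → V x

instance (r : ℕ) (x : M) : AddCommGroup (Copies r V x) :=
  inferInstanceAs (AddCommGroup (Fin r → V x))
instance (r : ℕ) (x : M) : Module ℂ (Copies r V x) := inferInstanceAs (Module ℂ (Fin r → V x))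
instance (r : ℕ) (x : M) : TopologicalSpace (Copies r V x) :=
  inferInstanceAs (TopologicalSpace (Fin r → V x))

namespace Copies

variable {F V}

/-- A trivialization of `V`, applied in each summand of `V ⊕ ⋯ ⊕ V`. -/
def triv (r : ℕ) (e : Trivialization F (π F V)) [e.IsLinear ℂ] :
    Pretrivialization (Fin r → F) (π (Fin r → F) (Copies r V)) where
  toFun x := (x.1, fun k => e.linearMapAt ℂ x.1 (x.2 k))
  invFun y := ⟨y.1, fun k => e.symmₗ ℂ y.1 (y.2 k)⟩
  source := TotalSpace.proj ⁻¹' e.baseSet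
  target := e.baseSet ×ˢ univ
  map_source' _ hx := ⟨hx, mem_univ _⟩
  map_target' _ hy := hy.1
  left_inv' := by
    rintro ⟨x, v⟩ hx
    simp only
    congr 1
    funext k
    exact e.symmₗ_linearMapAt hx (v k)
  right_inv' := by
    rintro ⟨x, c⟩ ⟨hx, -⟩
    simp only
    congr 1
    funext k
    exact e.linearMapAt_symmₗ hx (c k)
  open_target := e.open_baseSet.prod isOpen_univ
  baseSet := e.baseSet
  open_baseSet := e.open_baseSet
  source_eq := rfl
  target_eq := rfl
  proj_toFun _ _ := rfl

instance triv_linear (r : ℕ) (e : Trivialization F (π F V)) [e.IsLinear ℂ] :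
    (triv r e).IsLinear ℂ where
  linear x _ :=
    ⟨fun v w => funext fun k => (e.linearMapAt ℂ x).map_add (v k) (w k),
      fun c v => funext fun k => (e.linearMapAt ℂ x).map_smul c (v k)⟩

/-- A linear map applied in each coordinate. -/
def diag (r : ℕ) (T : F →L[ℂ] F) : (Fin r → F) →L[ℂ] (Fin r → F) :=
  ∑ k, ContinuousLinearMap.single ℂ (fun _ : Fin r => F) k ∘L T ∘L ContinuousLinearMap.proj k

lemma diag_apply (r : ℕ) (T : F →L[ℂ] F) (c : Fin r → F) (k : Fin r) :
    diag r T c k = T (c k) := by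
  simp [diag, Finset.sum_apply, Pi.single_apply]

lemma contDiff_diag (r : ℕ) : ContDiff ℂ ω (diag (F := F) r) := by
  unfold diag
  exact ContDiff.sum fun k _ =>
    contDiff_const.clm_comp (contDiff_id.clm_comp contDiff_const)

lemma trans_apply (r : ℕ) (e e' : Trivialization F (π F V)) [e.IsLinear ℂ] [e'.IsLinear ℂ]
    {x : M} (hx : x ∈ e.baseSet ∩ e'.baseSet) (c : Fin r → F) :
    diag r (e.coordChangeL ℂ e' x : F →L[ℂ] F) c = (triv r e' ⟨x, (triv r e).symm x c⟩).2 := by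
  have h : (triv r e).symm x c = fun k => e.symmₗ ℂ x (c k) := by
    rw [Pretrivialization.symm_apply _ (show x ∈ (triv r e).baseSet from hx.1)]
    rfl
  rw [h]
  funext k
  rw [diag_apply]
  change _ = e'.linearMapAt ℂ x (e.symmₗ ℂ x (c k))
  rw [e'.linearMapAt_apply (R := ℂ), if_pos hx.2, e.coe_symmₗ hx.1]
  exact Trivialization.coordChangeL_apply (R := ℂ) e e' hx (c k)

variable (F V) in
/-- The direct sum `V ⊕ ⋯ ⊕ V`, glued from its trivializations. -/
def prebundle (r : ℕ) : VectorPrebundle ℂ (Fin r → F) (Copies r V) where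
  pretrivializationAtlas := {t | ∃ (e : Trivialization F (π F V)) (_ : MemTrivializationAtlas e),
    t = triv r e}
  pretrivialization_linear' := by
    rintro _ ⟨e, _, rfl⟩
    infer_instance
  pretrivializationAt x := triv r (trivializationAt F V x)
  mem_base_pretrivializationAt x := mem_baseSet_trivializationAt F V x
  pretrivialization_mem_atlas x := ⟨trivializationAt F V x, inferInstance, rfl⟩
  exists_coordChange := by
    rintro _ ⟨e, _, rfl⟩ _ ⟨e', _, rfl⟩
    exact ⟨fun x => diag r (e.coordChangeL ℂ e' x : F →L[ℂ] F),
      (contDiff_diag r).continuous.comp_continuousOn (continuousOn_coordChange ℂ e e'),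
      fun x hx c => trans_apply r e e' hx c⟩
  totalSpaceMk_isInducing x := by
    have hx := mem_baseSet_trivializationAt F V x
    let g : V x ≃L[ℂ] F := (trivializationAt F V x).continuousLinearEquivAt ℂ x hx
    have hg : Topology.IsInducing (fun (v : Copies r V x) (k : Fin r) => g (v k)) :=
      Topology.IsInducing.piMap fun _ => g.toHomeomorph.isInducing
    have h2 : triv r (trivializationAt F V x) ∘ TotalSpace.mk x =
        Prod.mk x ∘ fun (v : Copies r V x) (k : Fin r) => g (v k) := by
      funext v
      refine Prod.ext rfl (funext fun k => ?_)
      change (trivializationAt F V x).linearMapAt ℂ x (v k) = g (v k)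
      rw [(trivializationAt F V x).linearMapAt_apply (R := ℂ), if_pos hx]
      rfl
    rw [h2]
    exact (isInducing_prodMkRight x).comp hg

instance (r : ℕ) : TopologicalSpace (TotalSpace (Fin r → F) (Copies r V)) :=
  (prebundle F V r).totalSpaceTopology

instance (r : ℕ) : FiberBundle (Fin r → F) (Copies r V) := (prebundle F V r).toFiberBundle

instance (r : ℕ) : VectorBundle ℂ (Fin r → F) (Copies r V) := (prebundle F V r).toVectorBundle

instance (r : ℕ) [ContMDiffVectorBundle ω F V 𝓘(ℂ, E)] :
    (prebundle F V r).IsContMDiff 𝓘(ℂ, E) ω where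
  exists_contMDiffCoordChange := by
    rintro _ ⟨e, _, rfl⟩ _ ⟨e', _, rfl⟩
    exact ⟨fun x => diag r (e.coordChangeL ℂ e' x : F →L[ℂ] F),
      (contDiff_diag r).contMDiff.comp_contMDiffOn (contMDiffOn_coordChangeL e e'),
      fun x hx c => trans_apply r e e' hx c⟩

/-- The direct sum of copies of a holomorphic vector bundle is a holomorphic vector bundle. -/
instance (r : ℕ) [ContMDiffVectorBundle ω F V 𝓘(ℂ, E)] :
    ContMDiffVectorBundle ω (Fin r → F) (Copies r V) 𝓘(ℂ, E) :=
  (prebundle F V r).contMDiffVectorBundle 𝓘(ℂ, E)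

end Copies

end Sums

section Metrics

variable (F : Type*) [NormedAddCommGroup F] [NormedSpace ℂ F]
  (V : M → Type*) [∀ x, AddCommGroup (V x)] [∀ x, Module ℂ (V x)]
  [∀ x, TopologicalSpace (V x)] [TopologicalSpace (TotalSpace F V)] [FiberBundle F V]

/-- `s` is a holomorphic section of `V` on `U`. -/
def IsHolomorphicOn (s : ∀ x, V x) (U : Set M) : Prop :=
  ContMDiffOn 𝓘(ℂ, E) (𝓘(ℂ, E).prod 𝓘(ℂ, F)) ω (fun x => TotalSpace.mk' F x (s x)) U

/-- `h` is a smooth Hermitian metric (conjugate-linear in the first variable) on the holomorphic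
vector bundle `V`. Smoothness is tested on local holomorphic sections, and refers to the
underlying real manifold of `M`. -/
structure IsHermitianMetric (h : ∀ x, V x → V x → ℂ) : Prop where
  add_right : ∀ x u v w, h x u (v + w) = h x u v + h x u w
  smul_right : ∀ x u (c : ℂ) v, h x u (c • v) = c * h x u v
  conj_symm : ∀ x u v, starRingEnd ℂ (h x u v) = h x v u
  pos : ∀ x v, v ≠ 0 → 0 < (h x v v).re
  smooth : ∀ (U : Set M) (s t : ∀ x, V x), IsOpen U → IsHolomorphicOn (E := E) F V s U →
    IsHolomorphicOn (E := E) F V t U → ContMDiffOn 𝓘(ℝ, E) 𝓘(ℝ, ℂ) ∞ (fun x => h x (s x) (t x)) U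

variable {V} in
/-- The metric on `V ⊕ ⋯ ⊕ V` for which the summands are orthogonal copies of `(V, h)`. -/
def copiesMetric (r : ℕ) (h : ∀ x, V x → V x → ℂ) (x : M) (v w : Copies r V x) : ℂ :=
  ∑ k, h x (v k) (w k)

/-- Two holomorphic vector bundles with fibre metrics are isomorphic: there is a fibrewise linear
isometric isomorphism, biholomorphic on the total spaces. -/
def AreIsomorphic {F₁ F₂ : Type*} [NormedAddCommGroup F₁] [NormedSpace ℂ F₁]
    [NormedAddCommGroup F₂] [NormedSpace ℂ F₂] {V₁ V₂ : M → Type*}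
    [∀ x, AddCommGroup (V₁ x)] [∀ x, Module ℂ (V₁ x)] [∀ x, TopologicalSpace (V₁ x)]
    [TopologicalSpace (TotalSpace F₁ V₁)] [FiberBundle F₁ V₁]
    [∀ x, AddCommGroup (V₂ x)] [∀ x, Module ℂ (V₂ x)] [∀ x, TopologicalSpace (V₂ x)]
    [TopologicalSpace (TotalSpace F₂ V₂)] [FiberBundle F₂ V₂]
    (h₁ : ∀ x, V₁ x → V₁ x → ℂ) (h₂ : ∀ x, V₂ x → V₂ x → ℂ) : Prop :=
  ∃ φ : ∀ x, V₁ x ≃ₗ[ℂ] V₂ x,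
    ContMDiff (𝓘(ℂ, E).prod 𝓘(ℂ, F₁)) (𝓘(ℂ, E).prod 𝓘(ℂ, F₂)) ω
      (fun v : TotalSpace F₁ V₁ => TotalSpace.mk' F₂ v.1 (φ v.1 v.2)) ∧
    ContMDiff (𝓘(ℂ, E).prod 𝓘(ℂ, F₂)) (𝓘(ℂ, E).prod 𝓘(ℂ, F₁)) ω
      (fun w : TotalSpace F₂ V₂ => TotalSpace.mk' F₁ w.1 ((φ w.1).symm w.2)) ∧
    ∀ x v w, h₂ x (φ x v) (φ x w) = h₁ x v w

end Metrics

/-- A holomorphic line bundle on `M` with a Hermitian metric. -/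
structure HermitianLineBundle (E : Type*) [NormedAddCommGroup E] [NormedSpace ℂ E]
    (M : Type*) [TopologicalSpace M] [ChartedSpace E M] where
  /-- the fibres -/
  Fib : M → Type
  [addCommGroup : ∀ x, AddCommGroup (Fib x)]
  [module : ∀ x, Module ℂ (Fib x)]
  [topFib : ∀ x, TopologicalSpace (Fib x)]
  [topTotal : TopologicalSpace (TotalSpace ℂ Fib)]
  [fiberBundle : FiberBundle ℂ Fib]
  [vectorBundle : VectorBundle ℂ ℂ Fib]
  [holomorphic : ContMDiffVectorBundle ω ℂ Fib 𝓘(ℂ, E)]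
  /-- the metric -/
  metric : ∀ x, Fib x → Fib x → ℂ
  isHermitianMetric : IsHermitianMetric (E := E) ℂ Fib metric

attribute [instance] HermitianLineBundle.addCommGroup HermitianLineBundle.module
  HermitianLineBundle.topFib HermitianLineBundle.topTotal HermitianLineBundle.fiberBundle
  HermitianLineBundle.vectorBundle HermitianLineBundle.holomorphic

/-! ### The Chern connection and its curvature -/

/-- `∂g(v)` for a complex-valued function on a complex vector space. -/
def del (g : E → ℂ) (z v : E) : ℂ :=
  (fderiv ℝ g z v - Complex.I * fderiv ℝ g z (Complex.I • v)) / 2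

/-- `∂̄g(v)` for a complex-valued function on a complex vector space. -/
def delbar (g : E → ℂ) (z v : E) : ℂ :=
  (fderiv ℝ g z v + Complex.I * fderiv ℝ g z (Complex.I • v)) / 2

/-- The connection form `θ = H⁻¹ ∂H` of the Chern connection, in a holomorphic frame with Gram
matrix `H i j = h (s i) (s j)`: one has `∇ (s j) = ∑ i, θ i j • s i`. -/
def connectionForm {r : ℕ} (H : E → Matrix (Fin r) (Fin r) ℂ) (z v : E) :
    Matrix (Fin r) (Fin r) ℂ :=
  (H z)⁻¹ * Matrix.of fun i j => del (fun w => H w i j) z v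

/-- The curvature form `Θ = dθ + θ ∧ θ = ∂̄θ = ∂̄(H⁻¹ ∂H)` of the Chern connection, evaluated on
the pair of (real) tangent vectors `u, v`. -/
def curvatureForm {r : ℕ} (H : E → Matrix (Fin r) (Fin r) ℂ) (z u v : E) :
    Matrix (Fin r) (Fin r) ℂ :=
  Matrix.of fun i j => delbar (fun w => connectionForm H w v i j) z u -
    delbar (fun w => connectionForm H w u i j) z v

/-- The curvature `R(u, v)` at `x` of the Chern connection of `(V, h)`, as a matrix in the basis of
`V x` given by a holomorphic frame `s`. It is computed in the preferred chart at `x`. -/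
def chernCurvature {V : M → Type*} (h : ∀ x, V x → V x → ℂ) {r : ℕ} (s : Fin r → ∀ x, V x)
    (x : M) (u v : TangentSpace 𝓘(ℂ, E) x) : Matrix (Fin r) (Fin r) ℂ :=
  curvatureForm (E := E)
    (fun z => Matrix.of fun i j => h ((extChartAt 𝓘(ℂ, E) x).symm z)
      (s i ((extChartAt 𝓘(ℂ, E) x).symm z)) (s j ((extChartAt 𝓘(ℂ, E) x).symm z)))
    (extChartAt 𝓘(ℂ, E) x x) u v

/-- The holomorphic vector bundle `V` with Hermitian metric `h` is projectively flat: its Chern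
connection has curvature `R = α Id` for some `2`-form `α`. (If `V` has positive rank then `α` is the
trace of the curvature divided by the rank, so it is automatically a smooth `(1,1)`-form.) -/
def IsProjectivelyFlatBundle (F : Type*) [NormedAddCommGroup F] [NormedSpace ℂ F]
    (V : M → Type*) [∀ x, AddCommGroup (V x)] [∀ x, Module ℂ (V x)]
    [∀ x, TopologicalSpace (V x)] [TopologicalSpace (TotalSpace F V)] [FiberBundle F V]
    (h : ∀ x, V x → V x → ℂ) : Prop :=
  ∃ α : ∀ x : M, TangentSpace 𝓘(ℂ, E) x → TangentSpace 𝓘(ℂ, E) x → ℂ,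
    ∀ (U : Set M) (s : Fin (Module.finrank ℂ F) → ∀ x, V x), IsOpen U →
      IsLocalFrameOn 𝓘(ℂ, E) F ω s U →
      ∀ x ∈ U, ∀ u v : TangentSpace 𝓘(ℂ, E) x, chernCurvature h s x u v = α x u v • 1

/-! ### Kähler metrics -/

/-- The Kähler form `ω(u, v) = g(i u, v)` of a Hermitian metric `h` on the holomorphic tangent
bundle, where `g = Re h`. -/
def kahlerForm (h : ∀ x : M, TangentSpace 𝓘(ℂ, E) x → TangentSpace 𝓘(ℂ, E) x → ℂ) (x : M)
    (u v : TangentSpace 𝓘(ℂ, E) x) : ℝ :=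
  (h x (Complex.I • u) v).re

/-- The Kähler form in the preferred chart at `x₀`. -/
def kahlerFormInChart (h : ∀ x : M, TangentSpace 𝓘(ℂ, E) x → TangentSpace 𝓘(ℂ, E) x → ℂ) (x₀ : M)
    (z u v : E) : ℝ :=
  kahlerForm h ((extChartAt 𝓘(ℂ, E) x₀).symm z)
    (mfderiv 𝓘(ℂ, E) 𝓘(ℂ, E) (extChartAt 𝓘(ℂ, E) x₀).symm z u)
    (mfderiv 𝓘(ℂ, E) 𝓘(ℂ, E) (extChartAt 𝓘(ℂ, E) x₀).symm z v)

/-- `h` is a Kähler metric on the complex manifold `M`: a Hermitian metric on the holomorphic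
tangent bundle whose Kähler form is closed. -/
structure IsKahlerMetric [IsManifold 𝓘(ℂ, E) ω M]
    (h : ∀ x : M, TangentSpace 𝓘(ℂ, E) x → TangentSpace 𝓘(ℂ, E) x → ℂ) : Prop where
  isHermitianMetric :
    IsHermitianMetric (E := E) E (fun x : M => TangentSpace 𝓘(ℂ, E) x) h
  closed : ∀ (x₀ : M), ∀ z ∈ (extChartAt 𝓘(ℂ, E) x₀).target, ∀ u v w : E,
    fderiv ℝ (fun y => kahlerFormInChart h x₀ y v w) z u +
    fderiv ℝ (fun y => kahlerFormInChart h x₀ y w u) z v +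
    fderiv ℝ (fun y => kahlerFormInChart h x₀ y u v) z w = 0

end Bundles

/-! ### The metrics of the Grassmannian -/

namespace Gr

variable {p n : ℕ}

/-- The metric on the universal quotient bundle, given by `ℂⁿ / U ≅ Uᗮ ⊆ ℂⁿ`. -/
def quotMetric (U : Gr p n) (x y : U.QFib) : ℂ :=
  inner ℂ (Submodule.quotientEquivOfIsCompl U.1 U.1ᗮ U.1.isCompl_orthogonal (U.quotEquiv x))
    (Submodule.quotientEquivOfIsCompl U.1 U.1ᗮ U.1.isCompl_orthogonal (U.quotEquiv y))

/-- The identification of the holomorphic tangent space at `U` with `Hom(U, ℂⁿ / U)`. In the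
graph chart centred at `U` the plane with coordinate `t A` is `{u + t A u}`, so the tangent vector
with coordinate `A` is `u ↦ A u mod U`. -/
def tangentHom (U : Gr p n) (A : TangentSpace 𝓘(ℂ, GrModel p n) U) : U.1 →ₗ[ℂ] U.QFib :=
  U.toQuot ∘ₗ (U.inclPerp : Cn (n - p) →ₗ[ℂ] Cn n) ∘ₗ
    ((show GrModel p n from A) : Cn p →ₗ[ℂ] Cn (n - p)) ∘ₗ
    (U.isoSub.toLinearEquiv : U.1 →ₗ[ℂ] Cn p)

/-- The Hermitian metric of Fubini-Study type on the Grassmannian: the metric of `S* ⊗ Q`, that is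
`⟨A, B⟩ = ∑ j, ⟨A eⱼ, B eⱼ⟩` for an orthonormal basis `eⱼ` of `U`. -/
def metric (U : Gr p n) (A B : TangentSpace 𝓘(ℂ, GrModel p n) U) : ℂ :=
  ∑ j, quotMetric U (U.tangentHom A (stdOrthonormalBasis ℂ U.1 j))
    (U.tangentHom B (stdOrthonormalBasis ℂ U.1 j))

end Gr

/-! ### Holomorphic maps to the Grassmannian -/

section Maps

variable {E : Type*} [NormedAddCommGroup E] [NormedSpace ℂ E]
  {M : Type*} [TopologicalSpace M] [ChartedSpace E M] {p n : ℕ}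

/-- Holomorphic maps `M → Gr_p(ℂⁿ)`. -/
abbrev HolMap (E : Type*) [NormedAddCommGroup E] [NormedSpace ℂ E]
    (M : Type*) [TopologicalSpace M] [ChartedSpace E M] (p n : ℕ) : Type _ :=
  C^ω⟮𝓘(ℂ, E), M; 𝓘(ℂ, GrModel p n), Gr p n⟯

/-- The fibres `ℂⁿ / f(x)` of the pull-back `f*Q` of the universal quotient bundle. Its holomorphic
structure is the pulled back one. -/
abbrev PullQuot (f : HolMap E M p n) : M → Type := (f : M → Gr p n) *ᵖ (Gr.QFib (p := p) (n := n))

instance (f : HolMap E M p n) (x : M) : AddCommGroup (PullQuot f x) :=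
  inferInstanceAs (AddCommGroup (Gr.QFib (f x)))

/-- The pull-back of the metric of the universal quotient bundle. -/
def pullQuotMetric (f : HolMap E M p n) (x : M) (v w : PullQuot f x) : ℂ :=
  Gr.quotMetric (f x) v w

/-- `f` is isometric: `f` pulls the metric of Fubini-Study type back to the metric `g` of `M`. -/
def IsIsometricMap (g : ∀ x : M, TangentSpace 𝓘(ℂ, E) x → TangentSpace 𝓘(ℂ, E) x → ℂ)
    (f : HolMap E M p n) : Prop :=
  ∀ (x : M) (u v : TangentSpace 𝓘(ℂ, E) x),
    Gr.metric (f x) (mfderiv 𝓘(ℂ, E) 𝓘(ℂ, GrModel p n) f x u)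
      (mfderiv 𝓘(ℂ, E) 𝓘(ℂ, GrModel p n) f x v) = g x u v

/-- `f` is projectively flat: `f*Q` is a projectively flat Hermitian vector bundle. -/
def IsProjectivelyFlat (f : HolMap E M p n) : Prop :=
  IsProjectivelyFlatBundle (E := E) (Cn (n - p)) (PullQuot f) (pullQuotMetric f)

/-- `f` is strongly projectively flat: `f*Q` is isomorphic, with holomorphic structure and
fibre metric, to the orthogonal direct sum of copies of a holomorphic Hermitian line bundle `L`
(the number of copies is the rank `n - p` of `Q`). -/
def IsStronglyProjectivelyFlat (f : HolMap E M p n) : Prop :=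
  ∃ L : HermitianLineBundle E M,
    AreIsomorphic (E := E) (F₁ := Fin (n - p) → ℂ) (F₂ := Cn (n - p))
      (V₁ := Copies (n - p) L.Fib) (V₂ := PullQuot f)
      (copiesMetric (n - p) L.metric) (pullQuotMetric f)

end Maps

end ProjFlat

end

open ProjFlat

/-!
# Projectively flat maps to Grassmannians are strongly projectively flat

Over the chart domain of the Grassmannian centred at `f x`, the fibre `ℂⁿ / f y` of `f*Q` is
identified with `W = ℂ^{n-p}`; the projection `ℂⁿ → ℂⁿ / f y ≅ W` becomes an operator `R y`
(`coordMap f x y`) which is holomorphic in `y`, and the metric of `f*Q` is `⟨K(y, y)⁻¹ ·, ·⟩`, where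
`K(w, z) = R(w) R(z)*` (`kernel`) is holomorphic in `w` and antiholomorphic in `z`. The
trivialization is normalized by `K(w, x) = 1`.

*Projectively flat implies strongly projectively flat.* The connection form is `-∂K K⁻¹` on the
diagonal, so if the curvature is scalar then so is `∂̄(∂K K⁻¹)`. This identity can be polarized: it
holds at all pairs `(w, z)` near `(x, x)`. Integrating in `z` from `x`, where `∂_w K` vanishes by
the normalization, and then in `w` shows that `K(w, z)` itself is scalar (`kernel_mem_scalars`).
Hence the trivializations at nearby points differ by scalar functions times constant unitary
operators. The constant unitary operators can be removed globally, whatever the fundamental group of `M`: the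
span `𝒱 x` of the operators `R y`, `y` near `x`, does not depend on the neighbourhood, by the
identity theorem, and moves only by unitary operators of `W` when `x` moves. Fixing one point in
each class of points with unitarily equivalent `𝒱 x` and rotating the other trivializations so that
`𝒱 x` becomes constant on the class, one obtains scalar transition functions
(`exists_scalar_transitions`), because `T T'*` is scalar for all `T`, `T'` in `𝒱 x`. These scalars are the cocycle of the line bundle `L`,
and `K(y, y)⁻¹`, now a scalar, is its metric.

*Strongly projectively flat implies projectively flat.* In a holomorphic frame of `L ⊕ ⋯ ⊕ L` the
Gram matrix is `ρ A* A` with `A` holomorphic and `ρ` the metric of `L`. The connection form is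
`∂ρ / ρ + A⁻¹ ∂A`, and `∂̄` kills the second term.
-/

noncomputable section

namespace ProjFlat

open Metric ContinuousLinearMap
open scoped InnerProduct ComplexConjugate

/-! ### Polarization and adjoints -/

section Polarization

variable {X : Type*} [NormedAddCommGroup X] [NormedSpace ℂ X] [FiniteDimensional ℂ X]

lemma mem_of_forall_clm_eq_zero (S : Submodule ℂ X) {x : X}
    (h : ∀ f : X →L[ℂ] ℂ, (∀ y ∈ S, f y = 0) → f x = 0) : x ∈ S := by
  by_contra hx
  obtain ⟨f, hf, hS⟩ := Submodule.exists_le_ker_of_notMem hx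
  exact hf (h (LinearMap.toContinuousLinearMap f) fun y hy => hS hy)

/-- A holomorphic curve which lies in the subspace `S` at real parameters lies in `S` at `i`, by the
identity theorem. -/
lemma mem_of_mem_real (S : Submodule ℂ X) {ψ : ℂ → X} (hψ : DifferentiableOn ℂ ψ (ball 0 2))
    (hS : ∀ t : ℝ, |t| < 2 → ψ t ∈ S) : ψ Complex.I ∈ S := by
  refine mem_of_forall_clm_eq_zero S fun f hf => ?_
  have han : AnalyticOnNhd ℂ (fun ζ => f (ψ ζ)) (ball 0 2) :=
    (f.differentiable.comp_differentiableOn hψ).analyticOnNhd isOpen_ball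
  have hfreq : ∃ᶠ ζ in 𝓝[≠] (0 : ℂ), f (ψ ζ) = 0 := by
    have ht : Filter.Tendsto (fun t : ℝ => (t : ℂ)) (𝓝[≠] 0) (𝓝[≠] 0) := by
      refine tendsto_nhdsWithin_iff.2 ⟨?_, ?_⟩
      · exact (Complex.continuous_ofReal.tendsto' 0 0 rfl).mono_left nhdsWithin_le_nhds
      · filter_upwards [self_mem_nhdsWithin] with t ht
        simpa using ht
    refine ht.frequently (Filter.Eventually.frequently ?_)
    filter_upwards [nhdsWithin_le_nhds (ball_mem_nhds (0 : ℝ) two_pos)] with t ht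
    exact hf _ (hS t (by simpa using ht))
  have := han.eqOn_zero_of_preconnected_of_frequently_eq_zero
    (convex_ball _ _).isPreconnected (by simp) hfreq
  exact this (show Complex.I ∈ ball (0 : ℂ) 2 by simp)

variable {E : Type*} [NormedAddCommGroup E] [NormedSpace ℂ E]

/-- Polarization: a function `Ψ w z`, holomorphic in `w` and antiholomorphic in `z`, whose values on
the diagonal lie in the subspace `S`, takes its values in `S`. The points `w` and `z` are the values
at `ζ = i` of the curves `m + ζ d` and `m + ζ̄ d`, which meet for real `ζ`. -/
lemma mem_of_mem_diagonal (S : Submodule ℂ X) {Ψ : E → E → X} {z₀ : E} {r : ℝ}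
    (hΨ : ∀ m d : E, (∀ ζ ∈ ball (0 : ℂ) 2, m + ζ • d ∈ ball z₀ r) →
      DifferentiableOn ℂ (fun ζ : ℂ => Ψ (m + ζ • d) (m + conj ζ • d)) (ball 0 2))
    (hS : ∀ z ∈ ball z₀ r, Ψ z z ∈ S) {w z : E} (hw : w ∈ ball z₀ (r / 3))
    (hz : z ∈ ball z₀ (r / 3)) : Ψ w z ∈ S := by
  set m : E := (2⁻¹ : ℂ) • (w + z) with hm
  set d : E := (-(Complex.I * 2⁻¹)) • (w - z) with hd
  have hI : Complex.I * Complex.I = -1 := Complex.I_mul_I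
  have h1 : m + Complex.I • d = w := by
    have : Complex.I * -(Complex.I * 2⁻¹) = (2⁻¹ : ℂ) := by linear_combination (-2⁻¹ : ℂ) * hI
    rw [hm, hd, smul_smul, this]
    module
  have h2 : m + conj Complex.I • d = z := by
    have : conj Complex.I * -(Complex.I * 2⁻¹) = (-2⁻¹ : ℂ) := by
      rw [Complex.conj_I]
      linear_combination (2⁻¹ : ℂ) * hI
    rw [hm, hd, smul_smul, this]
    module
  have hmem : ∀ ζ ∈ ball (0 : ℂ) 2, m + ζ • d ∈ ball z₀ r := by
    intro ζ hζ
    rw [mem_ball_zero_iff] at hζ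
    rw [mem_ball_iff_norm] at hw hz ⊢
    have e1 : m + ζ • d - z₀ = (2⁻¹ : ℂ) • ((w - z₀) + (z - z₀)) +
        (ζ * (-(Complex.I * 2⁻¹))) • ((w - z₀) - (z - z₀)) := by
      rw [hm, hd]; module
    have e2 : ‖(2⁻¹ : ℂ) • ((w - z₀) + (z - z₀))‖ ≤ 2⁻¹ * (‖w - z₀‖ + ‖z - z₀‖) := by
      rw [norm_smul]
      gcongr
      · simp
      · exact norm_add_le _ _
    have e3 : ‖(ζ * (-(Complex.I * 2⁻¹))) • ((w - z₀) - (z - z₀))‖ ≤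
        2 * 2⁻¹ * (‖w - z₀‖ + ‖z - z₀‖) := by
      rw [norm_smul]
      gcongr
      · simp only [norm_mul, norm_neg, Complex.norm_I, one_mul, norm_inv]
        gcongr
        simp
      · exact norm_sub_le _ _
    rw [e1]
    refine (norm_add_le _ _).trans_lt ?_
    linarith
  have := mem_of_mem_real S (hΨ m d hmem) fun t ht => by
    rw [Complex.conj_ofReal]
    exact hS _ (hmem t (by simpa using ht))
  rwa [h1, h2] at this

lemma mem_of_hasDerivAt_mem (S : Submodule ℂ X) {γ γ' : ℝ → X}
    (hγ : ∀ t ∈ Icc (0 : ℝ) 1, HasDerivAt γ (γ' t) t) (hS : ∀ t ∈ Icc (0 : ℝ) 1, γ' t ∈ S)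
    (h0 : γ 0 ∈ S) : γ 1 ∈ S := by
  refine mem_of_forall_clm_eq_zero S fun f hf => ?_
  have hd : ∀ t ∈ Icc (0 : ℝ) 1, HasDerivAt (fun t => f (γ t)) 0 t := fun t ht => by
    have := (f.restrictScalars ℝ).hasFDerivAt.comp_hasDerivAt t (hγ t ht)
    simpa [hf _ (hS t ht), Function.comp_def] using this
  have := constant_of_has_deriv_right_zero (f := fun t => f (γ t)) (a := 0) (b := 1)
    (fun t ht => (hd t ht).continuousAt.continuousWithinAt)
    (fun t ht => (hd t (Ico_subset_Icc_self ht)).hasDerivWithinAt) 1 (by simp)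
  exact this.trans (hf _ h0)

end Polarization

section Adjoint

variable {V W : Type*} [NormedAddCommGroup V] [InnerProductSpace ℂ V] [CompleteSpace V]
  [NormedAddCommGroup W] [InnerProductSpace ℂ W] [CompleteSpace W]

variable (V W) in
/-- The adjoint as a real continuous linear map. -/
def adjointRCLM : (V →L[ℂ] W) →L[ℝ] (W →L[ℂ] V) :=
  LinearMap.mkContinuous
    { toFun := fun T => T†
      map_add' := fun S T => map_add _ S T
      map_smul' := fun t T => by
        rw [← Complex.coe_smul, map_smulₛₗ]
        simp } 1
    (fun T => by simp)

@[simp] lemma adjointRCLM_apply (T : V →L[ℂ] W) : adjointRCLM V W T = T† := rfl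

/-- The adjoint is antilinear, so that `ζ ↦ F(ζ̄)*` is holomorphic if `F` is. -/
lemma differentiableAt_adjoint_conj {F : ℂ → V →L[ℂ] W} {ζ : ℂ}
    (hF : DifferentiableAt ℂ F (conj ζ)) :
    DifferentiableAt ℂ (fun ζ => (F (conj ζ))†) ζ := by
  have h1 := hF.hasDerivAt
  set F' := deriv F (conj ζ)
  have h2 : HasFDerivAt (fun ζ : ℂ => (F (conj ζ))†) _ ζ :=
    (adjointRCLM V W).hasFDerivAt.comp ζ
      ((h1.hasFDerivAt.restrictScalars ℝ).comp ζ Complex.conjCLE.hasFDerivAt)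
  refine (hasFDerivAt_of_restrictScalars ℝ h2
    (f' := (ContinuousLinearMap.toSpanSingleton ℂ (F'†))) ?_).differentiableAt
  ext1 h
  simp [ContinuousLinearMap.toSpanSingleton_apply, map_smulₛₗ]

end Adjoint

/-! ### Kernels with scalar curvature -/

lemma hasDerivAt_ringInverse {A : Type*} [NormedRing A] [NormedAlgebra ℝ A]
    [HasSummableGeomSeries A] {K : ℝ → A} {K' : A} {t : ℝ} (h : HasDerivAt K K' t)
    (hu : IsUnit (K t)) :
    HasDerivAt (fun t => Ring.inverse (K t))
      (-(Ring.inverse (K t) * K' * Ring.inverse (K t))) t := by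
  obtain ⟨k, hk⟩ := hu
  have h1 : HasFDerivAt Ring.inverse _ (K t) := hk ▸ hasFDerivAt_ringInverse (𝕜 := ℝ) k
  refine (h1.comp_hasDerivAt t h).congr_deriv ?_
  rw [← hk, Ring.inverse_unit, neg_apply, mulLeftRight_apply]

section LocalRigidity

variable {V W : Type*} [NormedAddCommGroup V] [InnerProductSpace ℂ V] [CompleteSpace V]
  [NormedAddCommGroup W] [InnerProductSpace ℂ W] [CompleteSpace W]
  {E : Type*} [NormedAddCommGroup E] [NormedSpace ℂ E]

variable (W) in
/-- The scalar operators. -/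
abbrev scalars : Submodule ℂ (W →L[ℂ] W) := Submodule.span ℂ {1}

/-- The kernel `K(w, z) = R(w) R(z)*`. -/
def kernel (R : E → V →L[ℂ] W) (w z : E) : W →L[ℂ] W := R w ∘L (R z)†

/-- The polarized connection form `∂_u K(w, z) K(w, z)⁻¹`. -/
def polConnection (R : E → V →L[ℂ] W) (w z u : E) : W →L[ℂ] W :=
  (fderiv ℂ R w u ∘L (R z)†) * Ring.inverse (kernel R w z)

/-- The polarized curvature form `∂̄_v (∂_u K(w, z) K(w, z)⁻¹)`. -/
def polCurvature (R : E → V →L[ℂ] W) (w z u v : E) : W →L[ℂ] W :=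
  ((fderiv ℂ R w u ∘L (1 - (R z)† ∘L Ring.inverse (kernel R w z) ∘L R w)) ∘L
    (fderiv ℂ R z v)†) * Ring.inverse (kernel R w z)

lemma hasDerivAt_line {X : Type*} [NormedAddCommGroup X] [NormedSpace ℂ X] {F : E → X} {z v : E}
    {t : ℝ} (h : DifferentiableAt ℂ F (z + t • v)) :
    HasDerivAt (fun t : ℝ => F (z + t • v)) (fderiv ℂ F (z + t • v) v) t := by
  have h1 : HasDerivAt (fun t : ℝ => z + t • v) v t := by
    simpa using ((hasDerivAt_id t).smul_const v).const_add z
  exact (h.hasFDerivAt.restrictScalars ℝ).comp_hasDerivAt t h1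

variable {R : E → V →L[ℂ] W} {z₀ : E} {r : ℝ}

lemma differentiableOn_polCurvature (hR : AnalyticOnNhd ℂ R (ball z₀ r))
    (hK : ∀ w ∈ ball z₀ r, ∀ z ∈ ball z₀ r, IsUnit (kernel R w z)) (u v m d : E)
    (hmd : ∀ ζ ∈ ball (0 : ℂ) 2, m + ζ • d ∈ ball z₀ r) :
    DifferentiableOn ℂ (fun ζ : ℂ => polCurvature R (m + ζ • d) (m + conj ζ • d) u v)
      (ball 0 2) := by
  intro ζ hζ
  refine DifferentiableAt.differentiableWithinAt ?_
  have hζ' : conj ζ ∈ ball (0 : ℂ) 2 := by simpa using hζ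
  have hl : ∀ ζ : ℂ, DifferentiableAt ℂ (fun ζ : ℂ => m + ζ • d) ζ := fun ζ => by fun_prop
  have h1 : DifferentiableAt ℂ (fun ζ : ℂ => R (m + ζ • d)) ζ :=
    (hR _ (hmd ζ hζ)).differentiableAt.comp ζ (hl ζ)
  have h2 : DifferentiableAt ℂ (fun ζ : ℂ => fderiv ℂ R (m + ζ • d) u) ζ :=
    ((hR.fderiv _ (hmd ζ hζ)).differentiableAt.comp ζ (hl ζ)).clm_apply
      (differentiableAt_const u)
  have h3 : DifferentiableAt ℂ (fun ζ : ℂ => (R (m + conj ζ • d))†) ζ :=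
    differentiableAt_adjoint_conj (F := fun ζ => R (m + ζ • d))
      (DifferentiableAt.comp (f := fun ζ : ℂ => m + ζ • d) _ (hR _ (hmd _ hζ')).differentiableAt
        (hl _))
  have h4 : DifferentiableAt ℂ (fun ζ : ℂ => (fderiv ℂ R (m + conj ζ • d) v)†) ζ :=
    differentiableAt_adjoint_conj (F := fun ζ => fderiv ℂ R (m + ζ • d) v)
      ((DifferentiableAt.comp (f := fun ζ : ℂ => m + ζ • d) _
        (hR.fderiv _ (hmd _ hζ')).differentiableAt (hl _)).clm_apply (differentiableAt_const v))
  have h5 : DifferentiableAt ℂ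
      (fun ζ : ℂ => Ring.inverse (kernel R (m + ζ • d) (m + conj ζ • d))) ζ := by
    obtain ⟨k, hk⟩ := hK _ (hmd ζ hζ) _ (hmd _ hζ')
    have := (hasFDerivAt_ringInverse (𝕜 := ℂ) k).differentiableAt
    rw [hk] at this
    exact this.comp ζ (h1.clm_comp h3)
  exact ((h2.clm_comp ((differentiableAt_const _).sub (h3.clm_comp (h5.clm_comp h1)))).clm_comp
    h4).mul h5

/-- `polCurvature` is the derivative of `polConnection` in the antiholomorphic variable. -/
lemma hasDerivAt_polConnection (hR : AnalyticOnNhd ℂ R (ball z₀ r))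
    {w z u v : E} {t : ℝ} (hz : z + t • v ∈ ball z₀ r) (hK : IsUnit (kernel R w (z + t • v))) :
    HasDerivAt (fun t : ℝ => polConnection R w (z + t • v) u)
      (polCurvature R w (z + t • v) u v) t := by
  have h1 : HasDerivAt (fun t : ℝ => (R (z + t • v))†) ((fderiv ℂ R (z + t • v) v)†) t :=
    (adjointRCLM V W).hasFDerivAt.comp_hasDerivAt t
      (hasDerivAt_line (hR _ hz).differentiableAt)
  have hl : ∀ T : V →L[ℂ] W, HasDerivAt (fun t : ℝ => T ∘L (R (z + t • v))†)
      (T ∘L (fderiv ℂ R (z + t • v) v)†) t := fun T =>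
    (((compL ℂ W V W) T).restrictScalars ℝ).hasFDerivAt.comp_hasDerivAt t h1
  have h2 := hasDerivAt_ringInverse (hl (R w)) hK
  have h3 := (hl (fderiv ℂ R w u)).mul h2
  refine h3.congr_deriv ?_
  simp only [polCurvature]
  ext x
  simp [kernel, sub_eq_add_neg]

/-- Local rigidity: if `R` is normalized at `z₀` and the curvature `∂̄(∂K K⁻¹)` on the
diagonal is scalar, then the kernel `K(w, z) = R(w) R(z)*` is scalar near `z₀`. -/
theorem kernel_mem_scalars [FiniteDimensional ℂ W] [Nontrivial W]
    (hR : AnalyticOnNhd ℂ R (ball z₀ r)) (hnorm : ∀ z ∈ ball z₀ r, kernel R z z₀ = 1)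
    (hK : ∀ w ∈ ball z₀ r, ∀ z ∈ ball z₀ r, ‖kernel R w z - 1‖ < 1)
    (hcurv : ∀ z ∈ ball z₀ r, ∀ u v, polCurvature R z z u v ∈ scalars W)
    {w z : E} (hw : w ∈ ball z₀ (r / 3)) (hz : z ∈ ball z₀ (r / 3)) :
    kernel R w z ∈ scalars W := by
  have hr : 0 < r / 3 := pos_of_mem_ball hw
  have hsub : ball z₀ (r / 3) ⊆ ball z₀ r := ball_subset_ball (by linarith)
  have hK' : ∀ w ∈ ball z₀ r, ∀ z ∈ ball z₀ r, IsUnit (kernel R w z) := fun w hw z hz => by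
    have := isUnit_one_sub_of_norm_lt_one (x := 1 - kernel R w z)
      (by rw [norm_sub_rev]; exact hK w hw z hz)
    simpa using this
  have hline : ∀ z ∈ ball z₀ (r / 3), ∀ t ∈ Icc (0 : ℝ) 1,
      z₀ + t • (z - z₀) ∈ ball z₀ (r / 3) := fun z hz t ht =>
    (convex_ball z₀ (r / 3)).add_smul_sub_mem (mem_ball_self hr) hz ht
  have h1 : ∀ w ∈ ball z₀ (r / 3), ∀ z ∈ ball z₀ (r / 3), ∀ u v,
      polCurvature R w z u v ∈ scalars W := fun w hw z hz u v =>
    mem_of_mem_diagonal (scalars W) (Ψ := fun w z => polCurvature R w z u v)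
      (fun m d hmd => differentiableOn_polCurvature hR hK' u v m d hmd)
      (fun z hz => hcurv z hz u v) hw hz
  -- The connection form vanishes at `z = z₀` because the frame is normalized there.
  have h2 : ∀ w ∈ ball z₀ (r / 3), ∀ z ∈ ball z₀ (r / 3), ∀ u,
      polConnection R w z u ∈ scalars W := by
    intro w hw z hz u
    have := mem_of_hasDerivAt_mem (scalars W)
      (γ := fun t : ℝ => polConnection R w (z₀ + t • (z - z₀)) u)
      (fun t ht => hasDerivAt_polConnection hR (hsub (hline z hz t ht))
        (hK' w (hsub hw) _ (hsub (hline z hz t ht))))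
      (fun t ht => h1 w hw _ (hline z hz t ht) u (z - z₀)) ?_
    · simpa using this
    · have h0 : fderiv ℂ R w u ∘L (R z₀)† = 0 := by
        have hd := (((compL ℂ W V W).flip ((R z₀)†)).hasFDerivAt.comp w
          (hR w (hsub hw)).differentiableAt.hasFDerivAt)
        have hc : (fun w => (compL ℂ W V W).flip ((R z₀)†) (R w)) =ᶠ[𝓝 w]
            fun _ => (1 : W →L[ℂ] W) := by
          filter_upwards [isOpen_ball.mem_nhds (hsub hw)] with y hy using hnorm y hy
        have := hd.unique ((hasFDerivAt_const (1 : W →L[ℂ] W) w).congr_of_eventuallyEq hc)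
        exact congrArg (fun T => T u) this
      simp [polConnection, h0]
  obtain ⟨e, he⟩ := exists_norm_eq W (zero_le_one)
  set Φ : (W →L[ℂ] W) →L[ℂ] ℂ := innerSL ℂ e ∘L ContinuousLinearMap.apply ℂ W e with hΦ
  have hΦ1 : Φ 1 = 1 := by simp [hΦ, he]
  have hΦb : ∀ T : W →L[ℂ] W, ‖Φ T‖ ≤ ‖T‖ := fun T => by
    have h1 : ‖Φ T‖ ≤ ‖e‖ * ‖T e‖ := by simpa [hΦ] using norm_inner_le_norm (𝕜 := ℂ) e (T e)
    have h2 := T.le_opNorm e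
    rw [he] at h1 h2
    linarith
  have hΦ0 : ∀ w ∈ ball z₀ r, ∀ z ∈ ball z₀ r, Φ (kernel R w z) ≠ 0 := fun w hw z hz h => by
    have := (hΦb (kernel R w z - 1)).trans_lt (hK w hw z hz)
    rw [map_sub, h, hΦ1] at this
    simp at this
  -- Along the segment from `z₀` to `w` one has `K' = s K` with scalar `s`, so that `K` divided by
  -- one of its diagonal coefficients is constant.
  have h3 := mem_of_hasDerivAt_mem (scalars W)
    (γ := fun t : ℝ => (Φ (kernel R (z₀ + t • (w - z₀)) z))⁻¹ •
      kernel R (z₀ + t • (w - z₀)) z) (γ' := fun _ => 0) ?_ (fun _ _ => Submodule.zero_mem _) ?_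
  · have h4 : z₀ + (1 : ℝ) • (w - z₀) = w := by simp
    simp only [h4] at h3
    have := Submodule.smul_mem _ (Φ (kernel R w z)) h3
    rwa [smul_inv_smul₀ (hΦ0 w (hsub hw) z (hsub hz))] at this
  · intro t ht
    have hwt := hline w hw t ht
    obtain ⟨s, hs⟩ := Submodule.mem_span_singleton.1 (h2 _ hwt z hz (w - z₀))
    have hKd : HasDerivAt (fun t : ℝ => kernel R (z₀ + t • (w - z₀)) z)
        (s • kernel R (z₀ + t • (w - z₀)) z) t := by
      have hl := ((((compL ℂ W V W).flip ((R z)†)).restrictScalars ℝ).hasFDerivAt.comp_hasDerivAt t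
        (hasDerivAt_line (z := z₀) (v := w - z₀) (hR _ (hsub hwt)).differentiableAt))
      refine hl.congr_deriv ?_
      have h5 : polConnection R (z₀ + t • (w - z₀)) z (w - z₀) * kernel R (z₀ + t • (w - z₀)) z =
          fderiv ℂ R (z₀ + t • (w - z₀)) (w - z₀) ∘L (R z)† := by
        rw [polConnection, mul_assoc, Ring.inverse_mul_cancel _ (hK' _ (hsub hwt) z (hsub hz)),
          mul_one]
      rw [← hs, smul_mul_assoc, one_mul] at h5
      exact h5.symm
    have hΦd := (Φ.restrictScalars ℝ).hasFDerivAt.comp_hasDerivAt t hKd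
    have hne := hΦ0 _ (hsub hwt) z (hsub hz)
    have := (hΦd.inv hne).smul hKd
    refine this.congr_deriv ?_
    simp only [Function.comp_apply, coe_restrictScalars', map_smul, Pi.inv_apply, smul_eq_mul]
    rw [smul_smul, ← add_smul]
    convert zero_smul ℂ _ using 2
    field_simp
    ring
  · have h6 : z₀ + (0 : ℝ) • (w - z₀) = z₀ := by simp
    have h7 : kernel R z₀ z = 1 := by
      have := congrArg (fun T => T†) (hnorm z (hsub hz))
      simpa [kernel, adjoint_comp, one_def, adjoint_id] using this
    simp only [h6, h7, hΦ1]
    simp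

end LocalRigidity

/-! ### The Chern connection in terms of the kernel -/

section Wirtinger

variable {E : Type*} [NormedAddCommGroup E] [NormedSpace ℂ E]
  {X : Type*} [NormedAddCommGroup X] [NormedSpace ℂ X]

lemma del_clm_comp (φ : X →L[ℂ] ℂ) {F : E → X} {F' : E →L[ℝ] X} {z : E}
    (hF : HasFDerivAt F F' z) (v : E) : del (fun w => φ (F w)) z v =
      φ ((2⁻¹ : ℂ) • (F' v - Complex.I • F' (Complex.I • v))) := by
  have h := ((φ.restrictScalars ℝ).hasFDerivAt.comp z hF).fderiv
  simp only [Function.comp_def, coe_restrictScalars'] at h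
  rw [del, h]
  simp [div_eq_inv_mul]

lemma delbar_clm_comp (φ : X →L[ℂ] ℂ) {F : E → X} {F' : E →L[ℝ] X} {z : E}
    (hF : HasFDerivAt F F' z) (v : E) : delbar (fun w => φ (F w)) z v =
      φ ((2⁻¹ : ℂ) • (F' v + Complex.I • F' (Complex.I • v))) := by
  have h := ((φ.restrictScalars ℝ).hasFDerivAt.comp z hF).fderiv
  simp only [Function.comp_def, coe_restrictScalars'] at h
  rw [delbar, h]
  simp [div_eq_inv_mul, mul_add]

lemma _root_.Filter.EventuallyEq.del_eq {f g : E → ℂ} {z : E} (h : f =ᶠ[𝓝 z] g) (v : E) :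
    del f z v = del g z v := by
  rw [del, del, h.fderiv_eq]

lemma _root_.Filter.EventuallyEq.delbar_eq {f g : E → ℂ} {z : E} (h : f =ᶠ[𝓝 z] g) (v : E) :
    delbar f z v = delbar g z v := by
  rw [delbar, delbar, h.fderiv_eq]

end Wirtinger

section OpMatrix

variable {W : Type*} [NormedAddCommGroup W] [InnerProductSpace ℂ W] {r : ℕ}
  (b : OrthonormalBasis (Fin r) ℂ W)

/-- The matrix of an operator in an orthonormal basis. -/
def opMatrix (T : W →L[ℂ] W) : Matrix (Fin r) (Fin r) ℂ :=
  Matrix.of fun i j => inner ℂ (b i) (T (b j))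

/-- A matrix coefficient as a linear functional of the operator. -/
def opCoeff (i j : Fin r) : (W →L[ℂ] W) →L[ℂ] ℂ :=
  innerSL ℂ (b i) ∘L ContinuousLinearMap.apply ℂ W (b j)

lemma opCoeff_apply (i j : Fin r) (T : W →L[ℂ] W) : opCoeff b i j T = opMatrix b T i j := rfl

lemma opMatrix_one : opMatrix b 1 = 1 := by
  ext i j
  simp [opMatrix, Matrix.one_apply, orthonormal_iff_ite.1 b.orthonormal]

lemma opMatrix_mul (S T : W →L[ℂ] W) : opMatrix b (S * T) = opMatrix b S * opMatrix b T := by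
  ext i j
  simp only [opMatrix, Matrix.of_apply, Matrix.mul_apply]
  change inner ℂ (b i) (S (T (b j))) = _
  conv_lhs => rw [← b.sum_repr (T (b j))]
  simp [b.repr_apply_apply, mul_comm]

lemma opMatrix_smul (c : ℂ) (T : W →L[ℂ] W) : opMatrix b (c • T) = c • opMatrix b T := by
  ext i j
  simp [opMatrix]

lemma opMatrix_injective : Function.Injective (opMatrix b) := by
  intro S T h
  have : (S : W →ₗ[ℂ] W) = T := by
    refine b.toBasis.ext fun j => InnerProductSpace.ext_inner_left_basis b.toBasis fun i => ?_
    simpa [opMatrix] using congrFun (congrFun h i) j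
  exact ContinuousLinearMap.coe_injective this

lemma opMatrix_inv {S T : W →L[ℂ] W} (h : T * S = 1) : (opMatrix b S)⁻¹ = opMatrix b T :=
  Matrix.inv_eq_left_inv (by rw [← opMatrix_mul, h, opMatrix_one])

end OpMatrix

section Curvature

variable {V W : Type*} [NormedAddCommGroup V] [InnerProductSpace ℂ V] [CompleteSpace V]
  [NormedAddCommGroup W] [InnerProductSpace ℂ W] [CompleteSpace W]
  {E : Type*} [NormedAddCommGroup E] [NormedSpace ℂ E] {r : ℕ}
  (b : OrthonormalBasis (Fin r) ℂ W)

variable (V W) in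
/-- Composition of operators as a real bilinear map. -/
def compRCLM : (V →L[ℂ] W) →L[ℝ] (W →L[ℂ] V) →L[ℝ] (W →L[ℂ] W) :=
  (ContinuousLinearMap.restrictScalarsL ℂ (W →L[ℂ] V) (W →L[ℂ] W) ℝ ℝ) ∘L
    (compL ℂ W V W).restrictScalars ℝ

lemma hasFDerivAt_comp_adjoint {F G : E → V →L[ℂ] W} {F' G' : E →L[ℝ] (V →L[ℂ] W)} {z : E}
    (hF : HasFDerivAt F F' z) (hG : HasFDerivAt G G' z) :
    ∃ T : E →L[ℝ] (W →L[ℂ] W), HasFDerivAt (fun y => F y ∘L (G y)†) T z ∧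
      ∀ v, T v = F z ∘L (G' v)† + F' v ∘L (G z)† :=
  ⟨_, (compRCLM V W).hasFDerivAt_of_bilinear hF ((adjointRCLM V W).hasFDerivAt.comp z hG),
    fun _ => rfl⟩

lemma _root_.HasFDerivAt.ringInverse_op {K : E → W →L[ℂ] W} {K' : E →L[ℝ] (W →L[ℂ] W)} {z : E}
    (h : HasFDerivAt K K' z) (hu : IsUnit (K z)) :
    ∃ T : E →L[ℝ] (W →L[ℂ] W), HasFDerivAt (fun y => Ring.inverse (K y)) T z ∧
      ∀ v, T v = -(Ring.inverse (K z) * K' v * Ring.inverse (K z)) := by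
  obtain ⟨k, hk⟩ := hu
  have h1 : HasFDerivAt Ring.inverse _ (K z) := hk ▸ hasFDerivAt_ringInverse (𝕜 := ℝ) k
  refine ⟨_, h1.comp z h, fun v => ?_⟩
  rw [← hk, Ring.inverse_unit]
  rfl

variable {R : E → V →L[ℂ] W} {z : E}

lemma hasFDerivAt_inverse_kernel (hR : DifferentiableAt ℂ R z) (hK : IsUnit (kernel R z z)) :
    ∃ T : E →L[ℝ] (W →L[ℂ] W), HasFDerivAt (fun y => Ring.inverse (kernel R y y)) T z ∧
      ∀ v, T v = -(Ring.inverse (kernel R z z) *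
        (R z ∘L (fderiv ℂ R z v)† + fderiv ℂ R z v ∘L (R z)†) *
        Ring.inverse (kernel R z z)) := by
  have hR' := hR.hasFDerivAt.restrictScalars ℝ
  obtain ⟨T, hT, hT'⟩ := hasFDerivAt_comp_adjoint hR' hR'
  obtain ⟨S, hS, hS'⟩ := hT.ringInverse_op hK
  exact ⟨S, hS, fun v => by rw [hS', hT']; rfl⟩

/-- In a frame with Gram matrix `K⁻¹` the connection form is `K ∂(K⁻¹) = -∂K K⁻¹`. -/
lemma connectionForm_eq {H : E → Matrix (Fin r) (Fin r) ℂ} (hR : DifferentiableAt ℂ R z)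
    (hK : IsUnit (kernel R z z))
    (hH : H =ᶠ[𝓝 z] fun y => opMatrix b (Ring.inverse (kernel R y y))) (v : E) :
    connectionForm H z v = opMatrix b (-polConnection R z z v) := by
  obtain ⟨T, hT, hT'⟩ := hasFDerivAt_inverse_kernel hR hK
  have h1 : (Matrix.of fun i j => del (fun w => H w i j) z v) =
      opMatrix b ((2⁻¹ : ℂ) • (T v - Complex.I • T (Complex.I • v))) := by
    ext i j
    have : (fun w => H w i j) =ᶠ[𝓝 z]
        fun w => opCoeff b i j (Ring.inverse (kernel R w w)) := by
      filter_upwards [hH] with w hw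
      rw [hw, opCoeff_apply]
    rw [Matrix.of_apply, this.del_eq, del_clm_comp _ hT, opCoeff_apply]
  rw [connectionForm, h1, hH.eq_of_nhds,
    opMatrix_inv b (T := kernel R z z) (Ring.mul_inverse_cancel _ hK), ← opMatrix_mul]
  congr 1
  have h2 : (2⁻¹ : ℂ) • (T v - Complex.I • T (Complex.I • v)) =
      -(Ring.inverse (kernel R z z) * (fderiv ℂ R z v ∘L (R z)†) *
        Ring.inverse (kernel R z z)) := by
    rw [hT', hT', map_smul, map_smulₛₗ, comp_smul, smul_comp, Complex.conj_I]
    simp only [mul_add, add_mul, mul_smul_comm, smul_mul_assoc, smul_add, smul_neg, neg_smul,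
      smul_smul, Complex.I_mul_I, mul_neg, neg_mul]
    module
  rw [h2, polConnection, mul_neg, ← mul_assoc, ← mul_assoc,
    Ring.mul_inverse_cancel _ hK, one_mul]

lemma delbar_polConnection (hR : AnalyticAt ℂ R z) (hK : IsUnit (kernel R z z)) (u v : E)
    (φ : (W →L[ℂ] W) →L[ℂ] ℂ) :
    delbar (fun w => φ (-polConnection R w w v)) z u = φ (-polCurvature R z z v u) := by
  obtain ⟨T, hT, hT'⟩ := hasFDerivAt_inverse_kernel hR.differentiableAt hK
  have hR' := hR.differentiableAt.hasFDerivAt.restrictScalars ℝ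
  have hD : DifferentiableAt ℂ (fun w => fderiv ℂ R w v) z :=
    hR.fderiv.differentiableAt.clm_apply (differentiableAt_const v)
  have hD' := hD.hasFDerivAt.restrictScalars ℝ
  obtain ⟨S, hS, hS'⟩ := hasFDerivAt_comp_adjoint hD' hR'
  have hP : HasFDerivAt (fun w => polConnection R w w v) _ z := hS.mul' hT
  have hφ : (fun w => φ (-polConnection R w w v)) = fun w => (-φ) (polConnection R w w v) := by
    ext w
    simp
  rw [hφ, delbar_clm_comp _ hP, neg_apply, map_neg]
  congr 2
  set D := fderiv ℂ (fun w => fderiv ℂ R w v) z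
  set G := Ring.inverse (kernel R z z) with hG
  simp only [add_apply, smul_apply, hS', hT', coe_restrictScalars',
    map_smul, map_smulₛₗ, Complex.conj_I, smul_eq_mul, op_smul_eq_mul, polCurvature,
    ← hG]
  ext x
  simp only [add_apply, smul_apply, mul_apply_eq_comp, comp_apply, sub_apply, neg_apply,
    one_apply_eq_self, map_add, map_smul, map_sub, map_neg]
  match_scalars <;> ring_nf <;> norm_num [Complex.I_sq]

/-- In a frame with Gram matrix `K⁻¹` the curvature form is the antisymmetrization of
`-∂̄(∂K K⁻¹)`. -/
theorem curvatureForm_eq {H : E → Matrix (Fin r) (Fin r) ℂ} (hR : AnalyticAt ℂ R z)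
    (hK : IsUnit (kernel R z z))
    (hH : H =ᶠ[𝓝 z] fun y => opMatrix b (Ring.inverse (kernel R y y))) (u v : E) :
    curvatureForm H z u v = opMatrix b (polCurvature R z z u v - polCurvature R z z v u) := by
  have hc : ∀ v, ∀ᶠ w in 𝓝 z, connectionForm H w v = opMatrix b (-polConnection R w w v) := by
    intro v
    have hKc : ContinuousAt (fun w => kernel R w w) z :=
      hR.continuousAt.clm_comp ((adjointRCLM V W).continuous.continuousAt.comp hR.continuousAt)
    filter_upwards [hR.eventually_analyticAt, hH.eventually_nhds,
      hKc.eventually (Units.isOpen.mem_nhds hK)] with w h1 h2 h3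
    exact connectionForm_eq b h1.differentiableAt h3 h2 v
  have hd : ∀ u v i j, delbar (fun w => connectionForm H w v i j) z u =
      opMatrix b (-polCurvature R z z v u) i j := by
    intro u v i j
    have : (fun w => connectionForm H w v i j) =ᶠ[𝓝 z]
        fun w => opCoeff b i j (-polConnection R w w v) := by
      filter_upwards [hc v] with w hw
      rw [hw, opCoeff_apply]
    rw [this.delbar_eq, delbar_polConnection hR hK, opCoeff_apply]
  ext i j
  rw [curvatureForm, Matrix.of_apply, hd, hd]
  simp only [← opCoeff_apply, ← map_sub]
  congr 1
  abel

/-- If the curvature is scalar then so is its polarized form. -/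
theorem polCurvature_mem_scalars {H : E → Matrix (Fin r) (Fin r) ℂ} (hR : AnalyticAt ℂ R z)
    (hK : IsUnit (kernel R z z))
    (hH : H =ᶠ[𝓝 z] fun y => opMatrix b (Ring.inverse (kernel R y y))) {α : E → E → ℂ}
    (hα : ∀ u v, curvatureForm H z u v = α u v • 1) (u v : E) :
    polCurvature R z z u v ∈ scalars W := by
  have hs : ∀ u v, polCurvature R z z u v - polCurvature R z z v u ∈ scalars W := by
    intro u v
    refine Submodule.mem_span_singleton.2 ⟨α u v, opMatrix_injective b ?_⟩
    rw [opMatrix_smul, opMatrix_one, ← hα, curvatureForm_eq b hR hK hH]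
  -- The polarized curvature is linear in `u` and antilinear in `v`, so replacing `u` by `i u`
  -- recovers it from its antisymmetrization.
  have h1 : polCurvature R z z (Complex.I • u) v = Complex.I • polCurvature R z z u v := by
    simp only [polCurvature, map_smul, smul_comp, smul_mul_assoc]
  have h2 : polCurvature R z z v (Complex.I • u) = -Complex.I • polCurvature R z z v u := by
    simp [polCurvature, map_smulₛₗ]
  have h3 : polCurvature R z z u v = (2⁻¹ : ℂ) • ((polCurvature R z z u v -
      polCurvature R z z v u) - Complex.I • (polCurvature R z z (Complex.I • u) v -
      polCurvature R z z v (Complex.I • u))) := by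
    rw [h1, h2]
    have hI : ∀ T : W →L[ℂ] W, Complex.I • Complex.I • T = -T := fun T => by
      rw [smul_smul, Complex.I_mul_I, neg_one_smul]
    rw [smul_sub Complex.I, neg_smul, smul_neg, hI, hI]
    module
  rw [h3]
  exact Submodule.smul_mem _ _ (Submodule.sub_mem _ (hs _ _) (Submodule.smul_mem _ _ (hs _ _)))

end Curvature

/-! ### The universal quotient bundle and its pull-back -/

section Surjective

variable {V W : Type*} [NormedAddCommGroup V] [InnerProductSpace ℂ V] [CompleteSpace V]
  [NormedAddCommGroup W] [InnerProductSpace ℂ W] [CompleteSpace W] [FiniteDimensional ℂ W]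

lemma isUnit_comp_adjoint {T : V →L[ℂ] W} (hT : Function.Surjective T) :
    IsUnit (T ∘L T†) := by
  rw [isUnit_iff_isUnit_toLinearMap, LinearMap.isUnit_iff_ker_eq_bot, LinearMap.ker_eq_bot']
  intro w hw
  have hw : T ((T†) w) = 0 := hw
  have h1 : (T†) w = 0 := by
    rw [← inner_self_eq_zero (𝕜 := ℂ), adjoint_inner_left, hw, inner_zero_right]
  obtain ⟨v, hv⟩ := hT w
  rw [← inner_self_eq_zero (𝕜 := ℂ)]
  nth_rewrite 2 [← hv]
  rw [← adjoint_inner_left, h1, inner_zero_left]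

/-- The orthogonal projection onto the orthogonal complement of the kernel of a surjective operator
`T` is `T* (T T*)⁻¹ T`. -/
lemma adjoint_inverse_apply {T : V →L[ℂ] W} (hT : Function.Surjective T) {v : V}
    (hv : ∀ w, T w = 0 → inner ℂ w v = 0) :
    (T†) (Ring.inverse (T ∘L T†) (T v)) = v := by
  have h1 : T ((T†) (Ring.inverse (T ∘L T†) (T v))) = T v :=
    congrArg (fun S : W →L[ℂ] W => S (T v)) (Ring.mul_inverse_cancel _ (isUnit_comp_adjoint hT))
  set w := (T†) (Ring.inverse (T ∘L T†) (T v)) - v with hw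
  have h2 : T w = 0 := by rw [hw, map_sub, h1, sub_self]
  have h3 : inner ℂ w w = 0 := by
    nth_rewrite 2 [hw]
    rw [inner_sub_right, adjoint_inner_right, h2, inner_zero_left, hv w h2, sub_zero]
  exact sub_eq_zero.1 (inner_self_eq_zero.1 h3)

end Surjective

namespace Gr

variable {p n : ℕ}

/-- The operator `ℂⁿ → ℂⁿ / W ≅ ℂ^{n-p}` given by the trivialization of the universal quotient
bundle over the chart domain of `U`. -/
def quotMap (U W : Gr p n) : Cn n →L[ℂ] Cn (n - p) :=
  U.coordPerp - U.slope W ∘L U.coordSub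

lemma quotCoord_toQuot' (U : Gr p n) {W : Gr p n} (hW : W ∈ U.dom) (v : Cn n) :
    U.quotCoord W (W.toQuot v) = U.quotMap W v :=
  U.quotCoord_toQuot hW v

@[simp] lemma quotMap_inclPerp (U W : Gr p n) (c : Cn (n - p)) :
    U.quotMap W (U.inclPerp c) = c := by
  simp [quotMap]

lemma quotMap_surjective (U W : Gr p n) : Function.Surjective (U.quotMap W) :=
  fun c => ⟨_, U.quotMap_inclPerp W c⟩

lemma quotMap_eq_zero (U : Gr p n) {W : Gr p n} (hW : W ∈ U.dom) {v : Cn n} :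
    U.quotMap W v = 0 ↔ v ∈ W.1 := by
  rw [← quotCoord_toQuot' U hW, ← W.toQuot_eq_zero]
  exact map_eq_zero_iff _ (U.quotCoord_injective hW)

lemma slope_self (U : Gr p n) : U.slope U = 0 := by
  have : U.coordPerp ∘L U.inclSub = 0 := by ext1 v; simp
  rw [slope, this, zero_comp]

lemma quotMap_self (U : Gr p n) : U.quotMap U = U.coordPerp := by
  rw [quotMap, slope_self, zero_comp, sub_zero]

lemma inclPerp_adjoint (U : Gr p n) : U.inclPerp† = U.coordPerp := by
  refine ((eq_adjoint_iff U.coordPerp U.inclPerp).2 fun v c => ?_).symm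
  have h1 : inner ℂ (U.inclPerp (U.coordPerp v)) (U.inclPerp c) =
      inner ℂ (U.coordPerp v) c := by
    simp [inclPerp, ← Submodule.coe_inner]
  have h2 : inner ℂ (U.inclSub (U.coordSub v)) (U.inclPerp c) = 0 :=
    Submodule.inner_right_of_mem_orthogonal (U.inclSub_mem _) (by simp [inclPerp])
  conv_rhs => rw [← U.decomp v, inner_add_left, h1, h2, zero_add]

lemma coordPerp_adjoint (U : Gr p n) : U.coordPerp† = U.inclPerp := by
  rw [← inclPerp_adjoint, adjoint_adjoint]

/-- The trivialization at `U` is normalized by `K(W, U) = 1`. -/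
lemma quotMap_comp_adjoint_self (U W : Gr p n) : U.quotMap W ∘L (U.quotMap U)† = 1 := by
  rw [quotMap_self, coordPerp_adjoint]
  ext1 c
  simp

/-- The trivializations over two chart domains differ by the transition function. -/
lemma quotMap_eq_quotTrans_comp {U U' W : Gr p n} (hU : W ∈ U.dom) (hU' : W ∈ U'.dom) :
    U'.quotMap W = quotTrans U U' W ∘L U.quotMap W := by
  ext1 v
  have h : v - U.inclPerp (U.quotMap W v) ∈ W.1 := by
    rw [← U.quotMap_eq_zero hU]
    simp
  rw [← U'.quotMap_eq_zero hU', map_sub, sub_eq_zero] at h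
  exact h

/-- The metric of the universal quotient bundle in a trivialization. -/
lemma quotMetric_toQuot (U : Gr p n) {W : Gr p n} (hW : W ∈ U.dom) (v w : Cn n) :
    quotMetric W (W.toQuot v) (W.toQuot w) =
      inner ℂ (U.quotMap W v) (Ring.inverse (U.quotMap W ∘L (U.quotMap W)†) (U.quotMap W w)) := by
  have key : ∀ v : Cn n, ∃ v' : (W.1ᗮ : Submodule ℂ (Cn n)), v - v' ∈ W.1 := fun v =>
    ⟨W.1ᗮ.orthogonalProjectionOnto v, by
      have := W.1.sub_starProjection_mem_orthogonal v
      have h2 := W.decomp v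
      have h3 : W.inclPerp (W.coordPerp v) = W.1ᗮ.orthogonalProjectionOnto v := by
        simp [inclPerp, coordPerp]
      rw [← h3, sub_eq_iff_eq_add.2 h2.symm]
      exact W.inclSub_mem _⟩
  have hq : ∀ {v v' : Cn n}, v - v' ∈ W.1 → W.toQuot v = W.toQuot v' ∧
      U.quotMap W v = U.quotMap W v' := fun {v v'} h =>
    ⟨sub_eq_zero.1 (by rw [← map_sub]; exact W.toQuot_eq_zero.2 h),
      sub_eq_zero.1 (by rw [← map_sub]; exact (U.quotMap_eq_zero hW).2 h)⟩
  obtain ⟨v', hv'⟩ := key v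
  obtain ⟨w', hw'⟩ := key w
  rw [(hq hv').1, (hq hv').2, (hq hw').1, (hq hw').2]
  have hc : ∀ x : (W.1ᗮ : Submodule ℂ (Cn n)),
      Submodule.quotientEquivOfIsCompl W.1 W.1ᗮ W.1.isCompl_orthogonal
        (W.quotEquiv (W.toQuot x)) = x :=
    fun x => Submodule.quotientEquivOfIsCompl_apply_mk_right W.1.isCompl_orthogonal x
  rw [quotMetric, hc, hc, Submodule.coe_inner, ← adjoint_inner_right,
    adjoint_inverse_apply (U.quotMap_surjective W)]
  intro x hx
  exact Submodule.inner_right_of_mem_orthogonal ((U.quotMap_eq_zero hW).1 hx) w'.2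

end Gr

section Maps

variable {E : Type*} [NormedAddCommGroup E] [NormedSpace ℂ E]
  {M : Type*} [TopologicalSpace M] [ChartedSpace E M] {p n : ℕ}

/-- The coordinate map `ℂⁿ → ℂⁿ / f(y) ≅ ℂ^{n-p}` in the trivialization of `f*Q` at `x`. -/
def coordMap (f : HolMap E M p n) (x y : M) : Cn n →L[ℂ] Cn (n - p) := (f x).quotMap (f y)

/-- The domain of the trivialization of `f*Q` at `x`. -/
def coordDom (f : HolMap E M p n) (x : M) : Set M := f ⁻¹' (f x).dom

lemma isOpen_coordDom (f : HolMap E M p n) (x : M) : IsOpen (coordDom f x) :=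
  (f x).isOpen_dom.preimage f.contMDiff.continuous

lemma mem_coordDom_self (f : HolMap E M p n) (x : M) : x ∈ coordDom f x := (f x).mem_dom_self

lemma contMDiffOn_coordMap (f : HolMap E M p n) (x : M) :
    ContMDiffOn 𝓘(ℂ, E) 𝓘(ℂ, Cn n →L[ℂ] Cn (n - p)) ω (coordMap f x) (coordDom f x) := by
  have h1 : ContMDiffOn 𝓘(ℂ, E) 𝓘(ℂ, GrModel p n) ω (fun y => (f x).slope (f y))
      (coordDom f x) :=
    (f x).contMDiffOn_slope.comp f.contMDiff.contMDiffOn fun y hy => hy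
  have h2 : ContDiff ℂ ω (fun A : GrModel p n => (f x).coordPerp - A ∘L (f x).coordSub) :=
    contDiff_const.sub (contDiff_id.clm_comp contDiff_const)
  exact h2.contMDiff.comp_contMDiffOn h1

lemma analyticAt_coordMap_chart [IsManifold 𝓘(ℂ, E) ω M] (f : HolMap E M p n) (x x' : M) {z : E}
    (hz : z ∈ (extChartAt 𝓘(ℂ, E) x').target)
    (hz' : (extChartAt 𝓘(ℂ, E) x').symm z ∈ coordDom f x) :
    AnalyticAt ℂ (fun z => coordMap f x ((extChartAt 𝓘(ℂ, E) x').symm z)) z := by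
  have h := ((contMDiffOn_coordMap f x).contMDiffAt ((isOpen_coordDom f x).mem_nhds hz')).comp z
    ((contMDiffOn_extChartAt_symm (I := 𝓘(ℂ, E)) (n := ω) x').contMDiffAt
      ((isOpen_extChartAt_target x').mem_nhds hz))
  exact (contMDiffAt_iff_contDiffAt.1 h).analyticAt

/-- The projection `ℂⁿ → ℂⁿ / f(y)` onto the fibre of `f*Q`. -/
def pullToQuot (f : HolMap E M p n) (y : M) : Cn n →ₗ[ℂ] PullQuot f y := (f y).toQuot

/-- The coordinate of the fibre of `f*Q` at `y` in the trivialization at `x`. -/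
def pullCoord (f : HolMap E M p n) (x y : M) : PullQuot f y →ₗ[ℂ] Cn (n - p) :=
  (f x).quotCoord (f y)

lemma pullCoord_toQuot (f : HolMap E M p n) {x y : M} (hy : y ∈ coordDom f x) (v : Cn n) :
    pullCoord f x y (pullToQuot f y v) = coordMap f x y v := (f x).quotCoord_toQuot' hy v

lemma pullCoord_injective (f : HolMap E M p n) {x y : M} (hy : y ∈ coordDom f x) :
    Function.Injective (pullCoord f x y) := (f x).quotCoord_injective hy

lemma pullCoord_toQuot_inclPerp (f : HolMap E M p n) {x y : M} (hy : y ∈ coordDom f x)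
    (c : Cn (n - p)) : pullCoord f x y (pullToQuot f y ((f x).inclPerp c)) = c :=
  (f x).quotCoord_inclPerp hy c

lemma pullQuotMetric_toQuot (f : HolMap E M p n) {x y : M} (hy : y ∈ coordDom f x)
    (v w : Cn n) : pullQuotMetric f y (pullToQuot f y v) (pullToQuot f y w) =
      inner ℂ (coordMap f x y v) (Ring.inverse (kernel (coordMap f x) y y) (coordMap f x y w)) :=
  (f x).quotMetric_toQuot hy v w

/-- The frame of `f*Q` which is constant in the trivialization at `x`. -/
def coordFrame (f : HolMap E M p n) (x : M) {r : ℕ} (b : Fin r → Cn (n - p)) (i : Fin r) (y : M) :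
    PullQuot f y :=
  pullToQuot f y ((f x).inclPerp (b i))

lemma isLocalFrameOn_coordFrame (f : HolMap E M p n) (x : M) {r : ℕ}
    (b : Module.Basis (Fin r) ℂ (Cn (n - p))) :
    IsLocalFrameOn 𝓘(ℂ, E) (Cn (n - p)) ω (coordFrame f x b) (coordDom f x) where
  linearIndependent {y} hy := by
    refine LinearIndependent.of_comp (pullCoord f x y) ?_
    have : (pullCoord f x y) ∘ (fun i => coordFrame f x b i y) = b :=
      funext fun i => pullCoord_toQuot_inclPerp f hy (b i)
    rw [this]
    exact b.linearIndependent
  generating {y} hy := by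
    intro v _
    have h : v = pullToQuot f y ((f x).inclPerp (pullCoord f x y v)) := by
      apply pullCoord_injective f hy
      rw [pullCoord_toQuot_inclPerp f hy]
    rw [h, ← b.sum_repr (pullCoord f x y v), map_sum, map_sum]
    refine Submodule.sum_mem _ fun i _ => ?_
    rw [map_smul, map_smul]
    exact Submodule.smul_mem _ _ (Submodule.subset_span ⟨i, rfl⟩)
  contMDiffOn i := by
    refine ((trivializationAt (Cn (n - p)) (PullQuot f) x).contMDiffOn_section_iff
      (isOpen_coordDom f x) subset_rfl).2 ?_
    refine (contMDiffOn_const (c := b i)).congr fun y hy => ?_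
    exact pullCoord_toQuot_inclPerp f hy (b i)

lemma pullQuotMetric_coordFrame (f : HolMap E M p n) (x : M) {r : ℕ} (b : Fin r → Cn (n - p))
    (i j : Fin r) {y : M} (hy : y ∈ coordDom f x) :
    pullQuotMetric f y (coordFrame f x b i y) (coordFrame f x b j y) =
      inner ℂ (b i) (Ring.inverse (kernel (coordMap f x) y y) (b j)) := by
  have := pullQuotMetric_toQuot f hy ((f x).inclPerp (b i)) ((f x).inclPerp (b j))
  rwa [coordMap, Gr.quotMap_inclPerp, Gr.quotMap_inclPerp] at this

end Maps

/-! ### Projectively flat maps near a point -/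

/-- Off the diagonal the kernel need not be invertible, but near a point where it is normalized it
is close to `1`. -/
lemma exists_norm_kernel_sub_one_lt {V W E : Type*} [NormedAddCommGroup V]
    [InnerProductSpace ℂ V] [CompleteSpace V] [NormedAddCommGroup W] [InnerProductSpace ℂ W]
    [CompleteSpace W] [TopologicalSpace E] {R : E → V →L[ℂ] W} {z₀ : E} (hR : ContinuousAt R z₀)
    (h1 : R z₀ ∘L (R z₀)† = 1) :
    ∃ t ∈ 𝓝 z₀, ∀ w ∈ t, ∀ z ∈ t, ‖R w ∘L (R z)† - 1‖ < 1 := by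
  have hfst : ContinuousAt (fun q : E × E => R q.1) (z₀, z₀) :=
    ContinuousAt.comp (f := Prod.fst) (x := (z₀, z₀)) hR continuousAt_fst
  have hsnd : ContinuousAt (fun q : E × E => R q.2) (z₀, z₀) :=
    ContinuousAt.comp (f := Prod.snd) (x := (z₀, z₀)) hR continuousAt_snd
  have hadj : ContinuousAt (fun q : E × E => (R q.2)†) (z₀, z₀) :=
    (adjointRCLM V W).continuous.continuousAt.comp hsnd
  have hc : ContinuousAt (fun q : E × E => ‖R q.1 ∘L (R q.2)† - 1‖) (z₀, z₀) :=
    ((hfst.clm_comp hadj).sub continuousAt_const).norm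
  have h2 : ∀ᶠ q : E × E in 𝓝 (z₀, z₀), ‖R q.1 ∘L (R q.2)† - 1‖ < 1 :=
    hc.eventually_lt continuousAt_const (by simp [h1])
  rw [nhds_prod_eq] at h2
  obtain ⟨t, ht, ht'⟩ := Filter.eventually_prod_self_iff
    (r := fun w z => ‖R w ∘L (R z)† - 1‖ < 1) |>.1 h2
  exact ⟨t, ht, ht'⟩

section FlatMaps

variable {E : Type*} [NormedAddCommGroup E] [NormedSpace ℂ E]
  {M : Type*} [TopologicalSpace M] [ChartedSpace E M] {p n : ℕ}

/-- The trivialization of `f*Q` at `x`, read in the chart of `M` at `x'`. -/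
def coordMapChart (f : HolMap E M p n) (x x' : M) (z : E) : Cn n →L[ℂ] Cn (n - p) :=
  coordMap f x ((extChartAt 𝓘(ℂ, E) x').symm z)

lemma isUnit_kernel_coordMapChart (f : HolMap E M p n) (x x' : M) (z : E) :
    IsUnit (kernel (coordMapChart f x x') z z) :=
  isUnit_comp_adjoint (Gr.quotMap_surjective _ _)

variable [IsManifold 𝓘(ℂ, E) ω M]

/-- The curvature condition at the centre of the chart of `M`, where the curvature is defined. -/
lemma polCurvature_coordMapChart_self {f : HolMap E M p n} (hf : IsProjectivelyFlat f) {x y : M}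
    (hy : y ∈ coordDom f x) (u v : E) :
    polCurvature (coordMapChart f x y) (extChartAt 𝓘(ℂ, E) y y) (extChartAt 𝓘(ℂ, E) y y) u v ∈
      scalars (Cn (n - p)) := by
  obtain ⟨α, hα⟩ := hf
  let b := stdOrthonormalBasis ℂ (Cn (n - p))
  have hα := hα _ _ (isOpen_coordDom f x) (isLocalFrameOn_coordFrame f x b.toBasis) y hy
  have hsymm : (extChartAt 𝓘(ℂ, E) y).symm (extChartAt 𝓘(ℂ, E) y y) = y := extChartAt_to_inv y
  refine polCurvature_mem_scalars b
    (analyticAt_coordMap_chart f x y (mem_extChartAt_target y) (by rwa [hsymm]))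
    (isUnit_kernel_coordMapChart f x y _) ?_ (α := α y) hα u v
  have hc : ContinuousAt (extChartAt 𝓘(ℂ, E) y).symm (extChartAt 𝓘(ℂ, E) y y) :=
    continuousAt_extChartAt_symm y
  filter_upwards [hc.preimage_mem_nhds ((isOpen_coordDom f x).mem_nhds (by rwa [hsymm]))] with z hz
  ext i j
  simpa using! pullQuotMetric_coordFrame f x b.toBasis i j hz

/-- The curvature condition does not depend on the chart of `M`. -/
lemma polCurvature_coordMapChart {f : HolMap E M p n} (hf : IsProjectivelyFlat f) {x x' : M} {z : E}
    (hz : z ∈ (extChartAt 𝓘(ℂ, E) x').target)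
    (hz' : (extChartAt 𝓘(ℂ, E) x').symm z ∈ coordDom f x) (u v : E) :
    polCurvature (coordMapChart f x x') z z u v ∈ scalars (Cn (n - p)) := by
  set y := (extChartAt 𝓘(ℂ, E) x').symm z with hy
  have hzs : z ∈ ((extChartAt 𝓘(ℂ, E) x').symm ≫ extChartAt 𝓘(ℂ, E) y).source := by
    rw [PartialEquiv.trans_source, PartialEquiv.symm_source]
    exact ⟨hz, mem_extChartAt_source y⟩
  let τ : E → E := extChartAt 𝓘(ℂ, E) y ∘ (extChartAt 𝓘(ℂ, E) x').symm
  have hτ : DifferentiableAt ℂ τ z := by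
    have := contDiffWithinAt_ext_coord_change (I := 𝓘(ℂ, E)) (n := ω) y x' hzs
    rw [modelWithCornersSelf_coe, range_id, contDiffWithinAt_univ] at this
    exact this.differentiableAt (by simp)
  have hτz : τ z = extChartAt 𝓘(ℂ, E) y y := rfl
  have hA := analyticAt_coordMap_chart f x y (mem_extChartAt_target y)
    (by rwa [extChartAt_to_inv])
  have hev : coordMapChart f x x' =ᶠ[𝓝 z] coordMapChart f x y ∘ τ := by
    have hc : ContinuousAt (extChartAt 𝓘(ℂ, E) x').symm z :=
      continuousAt_extChartAt_symm'' hz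
    filter_upwards [hc.preimage_mem_nhds (extChartAt_source_mem_nhds (I := 𝓘(ℂ, E)) y)] with w hw
    change _ = coordMap f x _
    rw [show (extChartAt 𝓘(ℂ, E) y).symm (τ w) = (extChartAt 𝓘(ℂ, E) x').symm w from
      (extChartAt 𝓘(ℂ, E) y).left_inv hw]
    rfl
  have hD : ∀ u, fderiv ℂ (coordMapChart f x x') z u =
      fderiv ℂ (coordMapChart f x y) (extChartAt 𝓘(ℂ, E) y y) (fderiv ℂ τ z u) := by
    intro u
    rw [hev.fderiv_eq, fderiv_comp z (hτz ▸ hA.differentiableAt) hτ]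
    rfl
  have h0 : coordMapChart f x x' z = coordMapChart f x y (extChartAt 𝓘(ℂ, E) y y) :=
    hev.eq_of_nhds
  have := polCurvature_coordMapChart_self hf hz' (fderiv ℂ τ z u) (fderiv ℂ τ z v)
  simpa only [polCurvature, hD, kernel, h0] using this

/-- Near every point the kernel of a projectively flat `f*Q` is scalar, and all small open sets give
the same span of coordinate maps. -/
theorem exists_scalar_neighborhood {f : HolMap E M p n} (hf : IsProjectivelyFlat f)
    [Nontrivial (Cn (n - p))] (x : M) :
    ∃ N : Set M, IsOpen N ∧ x ∈ N ∧ N ⊆ coordDom f x ∧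
      (∀ y ∈ N, ∀ z ∈ N, kernel (coordMap f x) y z ∈ scalars (Cn (n - p))) ∧
      ∀ O : Set M, IsOpen O → O.Nonempty → O ⊆ N →
        Submodule.span ℂ (coordMap f x '' O) = Submodule.span ℂ (coordMap f x '' N) := by
  set φ := extChartAt 𝓘(ℂ, E) x with hφ
  set z₀ := φ x with hz₀
  set R := coordMapChart f x x with hR
  have hx : φ.symm z₀ = x := extChartAt_to_inv x
  have hRx : R z₀ = coordMap f x x := congrArg (coordMap f x) hx
  have h1 : ∀ᶠ z in 𝓝 z₀, z ∈ φ.target ∧ φ.symm z ∈ coordDom f x :=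
    Filter.Eventually.and (extChartAt_target_mem_nhds x)
      ((continuousAt_extChartAt_symm x).preimage_mem_nhds
        ((isOpen_coordDom f x).mem_nhds (by rw [← hφ, ← hz₀, hx]; exact mem_coordDom_self f x)))
  have hRc : ContinuousAt R z₀ :=
    (analyticAt_coordMap_chart f x x (mem_extChartAt_target x)
      (by rw [← hφ, ← hz₀, hx]; exact mem_coordDom_self f x)).continuousAt
  obtain ⟨t, ht, ht'⟩ := exists_norm_kernel_sub_one_lt hRc
    (by rw [hRx]; exact Gr.quotMap_comp_adjoint_self _ _)
  obtain ⟨r, hr, hrt⟩ := Metric.mem_nhds_iff.1 (Filter.inter_mem h1 ht)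
  have han : AnalyticOnNhd ℂ R (ball z₀ r) := fun z hz =>
    analyticAt_coordMap_chart f x x (hrt hz).1.1 (hrt hz).1.2
  have hker : ∀ w ∈ ball z₀ (r / 3), ∀ z ∈ ball z₀ (r / 3),
      kernel R w z ∈ scalars (Cn (n - p)) := fun w hw z hz =>
    kernel_mem_scalars han
      (fun z _ => by rw [kernel, hRx]; exact Gr.quotMap_comp_adjoint_self _ _)
      (fun w hw z hz => ht' w (hrt hw).2 z (hrt hz).2)
      (fun z hz u v => polCurvature_coordMapChart hf (hrt hz).1.1 (hrt hz).1.2 u v) hw hz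
  have hsub : ball z₀ (r / 3) ⊆ ball z₀ r := ball_subset_ball (by linarith)
  refine ⟨φ.source ∩ φ ⁻¹' ball z₀ (r / 3), ?_, ?_, ?_, ?_, ?_⟩
  · exact isOpen_extChartAt_preimage' x isOpen_ball
  · exact ⟨mem_extChartAt_source x, mem_ball_self (by positivity)⟩
  · rintro y ⟨hy, hy'⟩
    have := (hrt (hsub hy')).1.2
    rwa [φ.left_inv hy] at this
  · rintro y ⟨hy, hy'⟩ z ⟨hz, hz'⟩
    have := hker _ hy' _ hz'
    simpa only [kernel, hR, coordMapChart, ← hφ, φ.left_inv hy, φ.left_inv hz] using this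
  -- A linear functional vanishing on the values over `O` vanishes on all values, by the identity
  -- theorem.
  · intro O hO hOne hON
    refine le_antisymm (Submodule.span_mono (image_mono hON)) (Submodule.span_le.2 ?_)
    rintro _ ⟨y, ⟨hy, hy'⟩, rfl⟩
    refine mem_of_forall_clm_eq_zero _ fun ℓ hℓ => ?_
    obtain ⟨o, ho⟩ := hOne
    have hbt : ball z₀ (r / 3) ⊆ φ.target := fun z hz => (hrt (hsub hz)).1.1
    have hev : (fun z => ℓ (R z)) =ᶠ[𝓝 (φ o)] 0 := by
      have hoc : ContinuousAt φ.symm (φ o) :=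
        continuousAt_extChartAt_symm'' (hbt (hON ho).2)
      filter_upwards [hoc.preimage_mem_nhds (hO.mem_nhds (by
        rwa [φ.left_inv (hON ho).1]))] with z hz
      exact hℓ _ (Submodule.subset_span ⟨_, hz, rfl⟩)
    have := (ℓ.analyticOnNhd univ |>.comp (han.mono hsub) (fun _ _ => mem_univ _)
      ).eqOn_zero_of_preconnected_of_eventuallyEq_zero (convex_ball _ _).isPreconnected (hON ho).2
        hev hy'
    simpa only [Function.comp_apply, hR, coordMapChart, ← hφ, φ.left_inv hy] using! this

end FlatMaps

/-! ### Rotation of the trivializations -/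

section UnitaryAction

variable {V W : Type*} [NormedAddCommGroup V] [InnerProductSpace ℂ V] [CompleteSpace V]
  [NormedAddCommGroup W] [InnerProductSpace ℂ W] [CompleteSpace W]

/-- The action of a unitary operator of `W` on operators with values in `W`. -/
def unitaryComp (u : W ≃ₗᵢ[ℂ] W) : (V →L[ℂ] W) →ₗ[ℂ] (V →L[ℂ] W) where
  toFun T := (u.toContinuousLinearEquiv : W →L[ℂ] W) ∘L T
  map_add' S T := by ext; simp
  map_smul' c T := by ext; simp

omit [CompleteSpace V] [CompleteSpace W] in
@[simp] lemma unitaryComp_apply (u : W ≃ₗᵢ[ℂ] W) (T : V →L[ℂ] W) (v : V) :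
    unitaryComp u T v = u (T v) := rfl

omit [CompleteSpace V] [CompleteSpace W] in
@[simp] lemma unitaryComp_symm_unitaryComp (u : W ≃ₗᵢ[ℂ] W) (T : V →L[ℂ] W) :
    unitaryComp u.symm (unitaryComp u T) = T := by
  ext; simp

omit [CompleteSpace V] [CompleteSpace W] in
@[simp] lemma unitaryComp_unitaryComp_symm (u : W ≃ₗᵢ[ℂ] W) (T : V →L[ℂ] W) :
    unitaryComp u (unitaryComp u.symm T) = T := by
  ext; simp

omit [CompleteSpace V] [CompleteSpace W] in
lemma unitaryComp_trans (u u' : W ≃ₗᵢ[ℂ] W) (T : V →L[ℂ] W) :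
    unitaryComp (u.trans u') T = unitaryComp u' (unitaryComp u T) := rfl

lemma adjoint_unitaryComp_apply (u : W ≃ₗᵢ[ℂ] W) (T : V →L[ℂ] W) (w : W) :
    ((unitaryComp u T)†) w = (T†) (u.symm w) := by
  refine ext_inner_right ℂ fun v => ?_
  rw [adjoint_inner_left, adjoint_inner_left, unitaryComp_apply, ← u.inner_map_map (u.symm w),
    u.apply_symm_apply]

omit [CompleteSpace V] [CompleteSpace W] in
/-- If `F'` and `u F` differ by nonvanishing scalar functions, then `u` maps the span of the values
of `F` into the span of the values of `F'`. -/
lemma unitaryComp_mem_span {M : Type*} {O : Set M} {F F' : M → V →L[ℂ] W} (u : W ≃ₗᵢ[ℂ] W)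
    {c : M → ℂ} (hc : ∀ y ∈ O, c y ≠ 0) (h : ∀ y ∈ O, F' y = c y • unitaryComp u (F y))
    {T : V →L[ℂ] W} (hT : T ∈ Submodule.span ℂ (F '' O)) :
    unitaryComp u T ∈ Submodule.span ℂ (F' '' O) := by
  have : Submodule.span ℂ (F '' O) ≤ (Submodule.span ℂ (F' '' O)).comap (unitaryComp u) := by
    rw [Submodule.span_le]
    rintro _ ⟨y, hy, rfl⟩
    have h1 : unitaryComp u (F y) = (c y)⁻¹ • F' y := by rw [h y hy, inv_smul_smul₀ (hc y hy)]
    rw [SetLike.mem_coe, Submodule.mem_comap, h1]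
    exact Submodule.smul_mem _ _ (Submodule.subset_span ⟨y, hy, rfl⟩)
  exact this hT

lemma comp_adjoint_mem_scalars_of_mem_span {S : Set (V →L[ℂ] W)}
    (hS : ∀ T ∈ S, ∀ T' ∈ S, T ∘L T'† ∈ scalars W) {T T' : V →L[ℂ] W}
    (hT : T ∈ Submodule.span ℂ S) (hT' : T' ∈ Submodule.span ℂ S) : T ∘L T'† ∈ scalars W := by
  induction hT, hT' using Submodule.span_induction₂ with
  | mem_mem x y hx hy => exact hS x hx y hy
  | zero_left y hy => rw [zero_comp]; exact Submodule.zero_mem _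
  | zero_right x hx => rw [map_zero, comp_zero]; exact Submodule.zero_mem _
  | add_left x y z _ _ _ h1 h2 => rw [add_comp]; exact Submodule.add_mem _ h1 h2
  | add_right x y z _ _ _ h1 h2 => rw [map_add, comp_add]; exact Submodule.add_mem _ h1 h2
  | smul_left c x y _ _ h => rw [smul_comp]; exact Submodule.smul_mem _ _ h
  | smul_right c x y _ _ h =>
    rw [map_smulₛₗ, comp_smul]; exact Submodule.smul_mem _ _ h

/-- An operator `g` with `g g*` scalar has an adjoint which is a multiple of a unitary operator. -/
lemma exists_unitary_of_smul_comp_adjoint [FiniteDimensional ℂ W] [Nontrivial W] {g : W →L[ℂ] W}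
    {κ : ℂ} (h : κ • (g ∘L g†) = 1) :
    ∃ (u : W ≃ₗᵢ[ℂ] W) (s : ℂ), s ≠ 0 ∧ ∀ w, u w = s • (g†) w := by
  have h1 : ∀ w, ‖κ‖ * ‖(g†) w‖ ^ 2 = ‖w‖ ^ 2 := by
    intro w
    have h2 := congrArg (fun T : W →L[ℂ] W => ‖inner ℂ w (T w)‖) h
    simp only [smul_apply, comp_apply, one_apply_eq_self, inner_smul_right] at h2
    rw [← adjoint_inner_left, inner_self_eq_norm_sq_to_K, inner_self_eq_norm_sq_to_K,
      norm_mul] at h2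
    simpa using h2
  have hκ : κ ≠ 0 := by
    rintro rfl
    rw [zero_smul] at h
    exact zero_ne_one h
  let s : ℝ := √‖κ‖
  have hs : s ^ 2 = ‖κ‖ := Real.sq_sqrt (norm_nonneg κ)
  have hs0 : 0 < s := Real.sqrt_pos.2 (norm_pos_iff.2 hκ)
  let l : W →ₗᵢ[ℂ] W :=
    { toLinearMap := ((s : ℂ) • (g†) : W →L[ℂ] W)
      norm_map' := fun w => by
        have : ‖(s : ℂ) • (g†) w‖ = ‖w‖ := by
          rw [norm_smul, ← sq_eq_sq₀ (by positivity) (by positivity), mul_pow, ← h1 w, ← hs]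
          simp
        exact this }
  exact ⟨l.toLinearIsometryEquiv rfl, s, by exact_mod_cast hs0.ne', fun w => rfl⟩

end UnitaryAction

section Global

variable {E : Type*} [NormedAddCommGroup E] [NormedSpace ℂ E]
  {M : Type*} [TopologicalSpace M] [ChartedSpace E M] {p n : ℕ}

/-- The transition function of `f*Q` from the trivialization at `x` to the one at `x'`. -/
def coordTrans (f : HolMap E M p n) (x x' y : M) : Cn (n - p) →L[ℂ] Cn (n - p) :=
  (f x).quotTrans (f x') (f y)

lemma coordMap_eq_coordTrans_comp (f : HolMap E M p n) {x x' y : M} (hy : y ∈ coordDom f x)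
    (hy' : y ∈ coordDom f x') : coordMap f x' y = coordTrans f x x' y ∘L coordMap f x y :=
  Gr.quotMap_eq_quotTrans_comp hy hy'

lemma contMDiffOn_coordTrans (f : HolMap E M p n) (x x' : M) :
    ContMDiffOn 𝓘(ℂ, E) 𝓘(ℂ, Cn (n - p) →L[ℂ] Cn (n - p)) ω (coordTrans f x x') (coordDom f x') :=
  (Gr.contMDiffOn_quotTrans (f x) (f x')).comp f.contMDiff.contMDiffOn fun _ hy => hy

lemma isUnit_kernel_coordMap (f : HolMap E M p n) (x y : M) :
    IsUnit (kernel (coordMap f x) y y) :=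
  isUnit_comp_adjoint (Gr.quotMap_surjective _ _)

lemma kernel_coordMap_self (f : HolMap E M p n) (x y : M) :
    kernel (coordMap f x) y x = 1 := Gr.quotMap_comp_adjoint_self _ _

/-- On a neighbourhood with scalar kernel, the trivializations at `x` and at a nearby point `x'`
differ by a constant unitary operator, up to scalar functions. -/
lemma exists_unitary_coordMap_eq (f : HolMap E M p n) [Nontrivial (Cn (n - p))] {x x' : M}
    {N : Set M} (hN : N ⊆ coordDom f x)
    (hK : ∀ y ∈ N, ∀ z ∈ N, kernel (coordMap f x) y z ∈ scalars (Cn (n - p))) (hx' : x' ∈ N) :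
    ∃ (u : Cn (n - p) ≃ₗᵢ[ℂ] Cn (n - p)) (c : M → ℂ), ∀ y ∈ N, y ∈ coordDom f x' →
      c y ≠ 0 ∧ coordMap f x' y = c y • unitaryComp u (coordMap f x y) := by
  set W := Cn (n - p)
  have h0 := coordMap_eq_coordTrans_comp f (hN hx') (mem_coordDom_self f x')
  set g₀ := coordTrans f x x' x'
  have h1 : ∀ y ∈ N, ∃ κ : ℂ, y ∈ coordDom f x' → κ • (coordTrans f x x' y ∘L g₀†) = 1 := by
    intro y hy
    obtain ⟨κ, hκ⟩ := Submodule.mem_span_singleton.1 (hK y hy x' hx')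
    refine ⟨κ, fun hy' => ?_⟩
    have h2 := kernel_coordMap_self f x' y
    rw [kernel, h0, coordMap_eq_coordTrans_comp f (hN hy) hy', adjoint_comp, comp_assoc,
      ← comp_assoc (coordMap f x y)] at h2
    change _ ∘L (kernel (coordMap f x) y x' ∘L _) = _ at h2
    rw [← hκ, smul_comp, comp_smul] at h2
    exact h2
  choose! κ hκ using h1
  obtain ⟨h, s, hs, hh⟩ := exists_unitary_of_smul_comp_adjoint (hκ x' hx' (mem_coordDom_self f x'))
  refine ⟨h.symm, fun y => s * (κ y)⁻¹, fun y hy hy' => ?_⟩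
  have hκy := hκ y hy hy'
  have hκ0 : κ y ≠ 0 := by
    intro h0
    rw [h0, zero_smul] at hκy
    exact zero_ne_one hκy
  refine ⟨mul_ne_zero hs (inv_ne_zero hκ0), ?_⟩
  rw [coordMap_eq_coordTrans_comp f (hN hy) hy']
  ext1 v
  set w := coordMap f x y v
  have h3 := congrArg (fun T : W →L[ℂ] W => T (h.symm w)) hκy
  simp only [smul_apply, comp_apply, one_apply_eq_self] at h3
  have h4 : (g₀†) (h.symm w) = s⁻¹ • w := by
    rw [eq_inv_smul_iff₀ hs, ← hh, h.apply_symm_apply]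
  rw [h4, map_smul, smul_smul] at h3
  rw [smul_apply, unitaryComp_apply, ← h3, smul_smul, comp_apply]
  have : s * (κ y)⁻¹ * (κ y * s⁻¹) = 1 := by field_simp
  rw [this, one_smul]

variable [IsManifold 𝓘(ℂ, E) ω M]

/-- For a projectively flat `f*Q` the trivializations can be rotated by constant unitary operators
such that all transition functions become scalar.

The span `𝒱 x` of the coordinate maps in the trivialization at `x` changes only by a unitary
operator when `x` moves. This gives an equivalence relation with open classes on `M`; comparing
`𝒱 x` with `𝒱 o`, where `o` represents the class of `x`, fixes the rotation at `x`. -/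
theorem exists_scalar_transitions {f : HolMap E M p n} (hf : IsProjectivelyFlat f)
    [Nontrivial (Cn (n - p))] :
    ∃ (N : M → Set M) (a : M → Cn (n - p) ≃ₗᵢ[ℂ] Cn (n - p)), (∀ x, IsOpen (N x)) ∧
      (∀ x, x ∈ N x) ∧ (∀ x, N x ⊆ coordDom f x) ∧
      (∀ x, ∀ y ∈ N x, kernel (coordMap f x) y y ∈ scalars (Cn (n - p))) ∧
      ∀ x x' y, y ∈ N x → y ∈ N x' → ∃ c : ℂ, ∀ w, coordTrans f x x' y (a x w) = c • a x' w := by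
  choose N hNo hxN hNd hK hspan using exists_scalar_neighborhood hf
  let 𝒱 : M → Submodule ℂ (Cn n →L[ℂ] Cn (n - p)) := fun x =>
    Submodule.span ℂ (coordMap f x '' N x)
  -- `x` and `x'` are related if a unitary operator maps `𝒱 x` onto `𝒱 x'`.
  let rel : Setoid M :=
    { r := fun x x' => ∃ u : Cn (n - p) ≃ₗᵢ[ℂ] Cn (n - p), ∀ T, T ∈ 𝒱 x ↔ unitaryComp u T ∈ 𝒱 x'
      iseqv :=
        { refl := fun x => ⟨.refl ℂ _, fun T => Iff.rfl⟩
          symm := by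
            rintro x x' ⟨u, hu⟩
            refine ⟨u.symm, fun T => ?_⟩
            rw [hu, unitaryComp_unitaryComp_symm]
          trans := by
            rintro x x' x'' ⟨u, hu⟩ ⟨u', hu'⟩
            exact ⟨u.trans u', fun T => by rw [hu, hu', unitaryComp_trans]⟩ } }
  have hrel : ∀ x, ∀ x' ∈ N x, rel x x' := by
    intro x x' hx'
    obtain ⟨u, c, hc⟩ := exists_unitary_coordMap_eq f (hNd x) (hK x) hx'
    have hO : IsOpen (N x ∩ N x') := (hNo x).inter (hNo x')
    have hne : (N x ∩ N x').Nonempty := ⟨x', hx', hxN x'⟩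
    have e1 : Submodule.span ℂ (coordMap f x '' (N x ∩ N x')) = 𝒱 x :=
      hspan x _ hO hne inter_subset_left
    have e2 : Submodule.span ℂ (coordMap f x' '' (N x ∩ N x')) = 𝒱 x' :=
      hspan x' _ hO hne inter_subset_right
    refine ⟨u, fun T => ?_⟩
    rw [← e1, ← e2]
    refine ⟨unitaryComp_mem_span u (fun y hy => (hc y hy.1 (hNd x' hy.2)).1)
      (fun y hy => (hc y hy.1 (hNd x' hy.2)).2), fun hT => ?_⟩
    have := unitaryComp_mem_span (F' := coordMap f x) u.symm (c := fun y => (c y)⁻¹)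
      (fun y hy => inv_ne_zero (hc y hy.1 (hNd x' hy.2)).1)
      (fun y hy => by
        have hcy := hc y hy.1 (hNd x' hy.2)
        rw [hcy.2, map_smul, inv_smul_smul₀ hcy.1, unitaryComp_symm_unitaryComp]) hT
    rwa [unitaryComp_symm_unitaryComp] at this
  let o : M → M := fun x => (Quotient.mk rel x).out
  have ho : ∀ x, rel x (o x) := fun x => rel.symm (Quotient.exact (Quotient.out_eq _))
  choose u hu using ho
  refine ⟨N, fun x => (u x).symm, hNo, hxN, hNd, fun x y hy => hK x y hy y hy, ?_⟩
  intro x x' y hy hy'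
  have hoo : o x = o x' := congrArg Quotient.out
    (Quotient.sound (rel.trans (hrel x y hy) (rel.symm (hrel x' y hy'))))
  -- Both rotated coordinate maps at `y` lie in `𝒱 (o x)`, so `T T'*` is scalar for them; dividing
  -- by the scalar kernel at `y` gives the transition function.
  have h1 : unitaryComp (u x) (coordMap f x y) ∈ 𝒱 (o x) :=
    (hu x _).1 (Submodule.subset_span ⟨y, hy, rfl⟩)
  have h2 : unitaryComp (u x') (coordMap f x' y) ∈ 𝒱 (o x) :=
    hoo ▸ (hu x' _).1 (Submodule.subset_span ⟨y, hy', rfl⟩)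
  have h3 := comp_adjoint_mem_scalars_of_mem_span (by
    rintro _ ⟨y, hy, rfl⟩ _ ⟨z, hz, rfl⟩
    exact hK _ y hy z hz) h2 h1
  obtain ⟨c, hc⟩ := Submodule.mem_span_singleton.1 h3
  obtain ⟨κ, hκ⟩ := Submodule.mem_span_singleton.1 (hK x y hy y hy)
  have hκ0 : κ ≠ 0 := by
    rintro rfl
    rw [zero_smul] at hκ
    exact not_isUnit_zero (hκ ▸ isUnit_kernel_coordMap f x y)
  refine ⟨κ⁻¹ * c, fun w => ?_⟩
  have h4 := congrArg (fun T : Cn (n - p) →L[ℂ] Cn (n - p) => T w) hc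
  have h5 := congrArg (fun T : Cn (n - p) →L[ℂ] Cn (n - p) => T ((u x).symm w)) hκ
  simp only [smul_apply, comp_apply, one_apply_eq_self, unitaryComp_apply,
    adjoint_unitaryComp_apply, kernel] at h4 h5
  rw [coordMap_eq_coordTrans_comp f (hNd x hy) (hNd x' hy'), comp_apply] at h4
  have h6 := h4.trans (congrArg (fun v => u x' (coordTrans f x x' y v)) h5.symm)
  simp only [map_smul] at h6
  rw [mul_smul, ← map_smul (u x').symm, h6, map_smul, inv_smul_smul₀ hκ0,
    (u x').symm_apply_apply]

end Global

/-! ### The line bundle of a scalar cocycle -/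

section RealSmooth

variable {E : Type*} [NormedAddCommGroup E] [NormedSpace ℂ E]
  {M : Type*} [TopologicalSpace M] [ChartedSpace E M]
  {F : Type*} [NormedAddCommGroup F] [NormedSpace ℂ F]

/-- Holomorphic maps are smooth for the underlying real structures. -/
lemma contMDiffWithinAt_real {f : M → F} {s : Set M} {x : M}
    (h : ContMDiffWithinAt 𝓘(ℂ, E) 𝓘(ℂ, F) ω f s x) :
    ContMDiffWithinAt 𝓘(ℝ, E) 𝓘(ℝ, F) ∞ f s x := by
  rw [contMDiffWithinAt_iff] at h ⊢
  exact ⟨h.1, (h.2.restrict_scalars ℝ).of_le le_top⟩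

end RealSmooth

section CopiesTriv

variable {E : Type*} [NormedAddCommGroup E] [NormedSpace ℂ E]
  {M : Type*} [TopologicalSpace M] [ChartedSpace E M]
  {F : Type*} [NormedAddCommGroup F] [NormedSpace ℂ F]
  {V : M → Type*} [∀ x, AddCommGroup (V x)] [∀ x, Module ℂ (V x)]
  [∀ x, TopologicalSpace (V x)] [TopologicalSpace (TotalSpace F V)] [FiberBundle F V]
  [VectorBundle ℂ F V]

lemma trivializationAt_copies_apply (r : ℕ) {x y : M}
    (hy : y ∈ (trivializationAt F V x).baseSet) (v : Copies r V y) (k : Fin r) :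
    (trivializationAt (Fin r → F) (Copies r V) x ⟨y, v⟩).2 k =
      (trivializationAt F V x ⟨y, v k⟩).2 := by
  change (trivializationAt F V x).linearMapAt ℂ y (v k) = _
  rw [(trivializationAt F V x).linearMapAt_apply (R := ℂ), if_pos hy]

end CopiesTriv

section LineBundle

variable {E : Type*} [NormedAddCommGroup E] [NormedSpace ℂ E]
  {M : Type*} [TopologicalSpace M] [ChartedSpace E M] {p n : ℕ}

/-- The trivialization of `f*Q` at `y`, in the fibre at `y`. -/
def pullFrameEquiv (f : HolMap E M p n) (y : M) : Cn (n - p) ≃ₗ[ℂ] PullQuot f y where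
  toFun c := pullToQuot f y ((f y).inclPerp c)
  map_add' v w := by rw [map_add, map_add]
  map_smul' c v := by rw [map_smul, map_smul]; rfl
  invFun := pullCoord f y y
  left_inv c := pullCoord_toQuot_inclPerp f (mem_coordDom_self f y) c
  right_inv v := pullCoord_injective f (mem_coordDom_self f y)
    (pullCoord_toQuot_inclPerp f (mem_coordDom_self f y) _)

/-- Unitary rotations `rot x` of the trivializations of `f*Q` after which all transition functions
are scalar, together with the cocycle `trans` of these scalars and a Hermitian metric `norm` for it:
`norm x` is the square norm of the frame at `x` of the line bundle defined by the cocycle. -/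
structure ScalarTransitions (f : HolMap E M p n) where
  /-- the domain of the rotated trivialization at `x` -/
  dom : M → Set M
  isOpen_dom : ∀ x, IsOpen (dom x)
  mem_dom : ∀ x, x ∈ dom x
  dom_subset : ∀ x, dom x ⊆ coordDom f x
  /-- the rotation of the trivialization at `x` -/
  rot : M → Cn (n - p) ≃ₗᵢ[ℂ] Cn (n - p)
  /-- the scalar transition functions -/
  trans : M → M → M → ℂ
  coordTrans_rot : ∀ x x' y, y ∈ dom x → y ∈ dom x' → ∀ w,
    coordTrans f x x' y (rot x w) = trans x x' y • rot x' w
  trans_self : ∀ x, ∀ y ∈ dom x, trans x x y = 1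
  trans_comp : ∀ x x' x'' y, y ∈ dom x → y ∈ dom x' → y ∈ dom x'' →
    trans x' x'' y * trans x x' y = trans x x'' y
  contMDiffOn_trans : ∀ x x', ContMDiffOn 𝓘(ℂ, E) 𝓘(ℂ, ℂ) ω (trans x x') (dom x ∩ dom x')
  /-- the square norms of the frames -/
  norm : M → M → ℂ
  norm_self : ∀ x, norm x x = 1
  norm_trans : ∀ x x' y, y ∈ dom x → y ∈ dom x' →
    norm x y = conj (trans x x' y) * trans x x' y * norm x' y
  contMDiffOn_norm : ∀ x, ContMDiffOn 𝓘(ℝ, E) 𝓘(ℝ, ℂ) ∞ (norm x) (dom x)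

namespace ScalarTransitions

variable {f : HolMap E M p n} (D : ScalarTransitions f)

/-- The line bundle defined by the cocycle of scalar transition functions. -/
def core : VectorBundleCore ℂ M ℂ M where
  baseSet := D.dom
  isOpen_baseSet := D.isOpen_dom
  indexAt := id
  mem_baseSet_at := D.mem_dom
  coordChange x x' y := D.trans x x' y • ContinuousLinearMap.id ℂ ℂ
  coordChange_self x y hy v := by simp [D.trans_self x y hy]
  continuousOn_coordChange x x' :=
    (D.contMDiffOn_trans x x').continuousOn.smul continuousOn_const
  coordChange_comp x x' x'' y hy v := by
    simp [← D.trans_comp x x' x'' y hy.1.1 hy.1.2 hy.2, mul_assoc]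

instance : D.core.IsContMDiff 𝓘(ℂ, E) ω where
  contMDiffOn_coordChange x x' :=
    (contDiff_id.smul contDiff_const : ContDiff ℂ ω fun c : ℂ => c • ContinuousLinearMap.id ℂ ℂ
      ).contMDiff.comp_contMDiffOn (D.contMDiffOn_trans x x')

/-- The coordinate of the fibre at `y` of the line bundle in the frame at `y`. -/
def fiberEquiv (y : M) : D.core.Fiber y ≃ₗ[ℂ] ℂ := LinearEquiv.refl ℂ ℂ

/-- The metric of the line bundle; the frame at `y` has norm one at `y`. -/
def metric (y : M) (v w : D.core.Fiber y) : ℂ := conj (D.fiberEquiv y v) * D.fiberEquiv y w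

/-- The chosen trivialization at `x` is the one of the cocycle, as the frame index at `y` is `y`. -/
lemma trivializationAt_core_apply (x y : M) (v : D.core.Fiber y) :
    (trivializationAt ℂ D.core.Fiber x ⟨y, v⟩).2 = D.trans y x y * D.fiberEquiv y v := rfl

lemma metric_eq {x y : M} (hy : y ∈ D.dom x) (v w : D.core.Fiber y) :
    D.metric y v w = conj (trivializationAt ℂ D.core.Fiber x ⟨y, v⟩).2 *
      (trivializationAt ℂ D.core.Fiber x ⟨y, w⟩).2 * D.norm x y := by
  rw [trivializationAt_core_apply, trivializationAt_core_apply, map_mul, metric]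
  have := D.norm_trans y x y (D.mem_dom y) hy
  rw [D.norm_self] at this
  linear_combination (conj (D.fiberEquiv y v) * D.fiberEquiv y w) * this

lemma isHermitianMetric : IsHermitianMetric (E := E) ℂ D.core.Fiber D.metric where
  add_right x u v w := by rw [metric, map_add, mul_add]; rfl
  smul_right x u c v := by rw [metric, map_smul, smul_eq_mul, mul_left_comm]; rfl
  conj_symm x u v := by rw [metric, metric, map_mul, Complex.conj_conj, mul_comm]
  pos x v hv := by
    rw [metric, ← Complex.normSq_eq_conj_mul_self, Complex.ofReal_re]
    exact Complex.normSq_pos.2 ((D.fiberEquiv x).map_ne_zero_iff.2 hv)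
  smooth U s t hU hs ht x hx := by
    have hs' := contMDiffWithinAt_real (contMDiffWithinAt_section.1 (hs x hx))
    have ht' := contMDiffWithinAt_real (contMDiffWithinAt_section.1 (ht x hx))
    have hmul : ContDiff ℝ ∞ (fun q : ℂ × ℂ × ℂ => conj q.1 * q.2.1 * q.2.2) :=
      ((Complex.conjCLE.contDiff.comp contDiff_fst).mul (contDiff_fst.comp contDiff_snd)).mul
        (contDiff_snd.comp contDiff_snd)
    have hn : ContMDiffWithinAt 𝓘(ℝ, E) 𝓘(ℝ, ℂ) ∞ (D.norm x) U x :=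
      ((D.contMDiffOn_norm x).contMDiffAt ((D.isOpen_dom x).mem_nhds (D.mem_dom x))
        ).contMDiffWithinAt
    refine (hmul.contMDiff.contMDiffAt.comp_contMDiffWithinAt x
      (hs'.prodMk_space (ht'.prodMk_space hn))).congr_of_eventuallyEq ?_
      (D.metric_eq (D.mem_dom x) _ _)
    filter_upwards [nhdsWithin_le_nhds ((D.isOpen_dom x).mem_nhds (D.mem_dom x))] with y hy
    exact D.metric_eq hy _ _

/-- The holomorphic Hermitian line bundle defined by scalar transition functions. -/
def lineBundle : HermitianLineBundle E M where
  Fib := D.core.Fiber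
  metric := D.metric
  isHermitianMetric := D.isHermitianMetric

/-- The coordinates of the fibre at `y` of the sum of copies of the line bundle. -/
def copiesEquiv (y : M) : Copies (n - p) D.core.Fiber y ≃ₗ[ℂ] Cn (n - p) :=
  (WithLp.linearEquiv 2 ℂ (Fin (n - p) → ℂ)).symm

/-- The isomorphism from the sum of copies of the line bundle to `f*Q`: the identity in the
trivializations at `y`, up to the rotation at `y`. -/
def iso (y : M) : Copies (n - p) D.core.Fiber y ≃ₗ[ℂ] PullQuot f y :=
  D.copiesEquiv y ≪≫ₗ (D.rot y).toLinearEquiv ≪≫ₗ pullFrameEquiv f y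

lemma iso_apply (y : M) (v : Copies (n - p) D.core.Fiber y) :
    D.iso y v = pullToQuot f y ((f y).inclPerp (D.rot y (D.copiesEquiv y v))) := rfl

/-- In the trivializations at `x` the isomorphism is the rotation at `x`. -/
lemma pullCoord_iso {x y : M} (hy : y ∈ D.dom x) (v : Copies (n - p) D.core.Fiber y) :
    pullCoord f x y (D.iso y v) = D.rot x (WithLp.toLp 2
      (trivializationAt (Fin (n - p) → ℂ) (Copies (n - p) D.core.Fiber) x ⟨y, v⟩).2) := by
  have h2 : D.trans y x y • D.copiesEquiv y v = WithLp.toLp 2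
      (trivializationAt (Fin (n - p) → ℂ) (Copies (n - p) D.core.Fiber) x ⟨y, v⟩).2 := by
    ext k
    exact (trivializationAt_copies_apply (V := D.core.Fiber) (n - p) hy v k).symm
  rw [iso_apply, pullCoord_toQuot f (D.dom_subset x hy),
    coordMap_eq_coordTrans_comp f (mem_coordDom_self f y) (D.dom_subset x hy), comp_apply,
    coordMap, Gr.quotMap_inclPerp, D.coordTrans_rot y x y (D.mem_dom y) hy, ← map_smul, h2]

lemma metric_iso (y : M) (v w : Copies (n - p) D.core.Fiber y) :
    pullQuotMetric f y (D.iso y v) (D.iso y w) = copiesMetric (n - p) D.metric y v w := by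
  rw [iso_apply, iso_apply, pullQuotMetric_toQuot f (mem_coordDom_self f y),
    kernel_coordMap_self, Ring.inverse_one, coordMap, Gr.quotMap_inclPerp,
    Gr.quotMap_inclPerp, one_apply_eq_self, LinearIsometryEquiv.inner_map_map,
    PiLp.inner_apply]
  exact Finset.sum_congr rfl fun k _ => mul_comm _ _

theorem isStronglyProjectivelyFlat (D : ScalarTransitions f) : IsStronglyProjectivelyFlat f := by
  refine ⟨D.lineBundle, D.iso, ?_, ?_, ?_⟩
  · intro v₀
    rw [contMDiffAt_totalSpace]
    have h0 := contMDiffAt_totalSpace.1 (contMDiffAt_id (I := 𝓘(ℂ, E).prod 𝓘(ℂ, Fin (n - p) → ℂ))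
      (n := ω) (x := v₀))
    refine ⟨h0.1, ?_⟩
    have h1 : ContDiff ℂ ω (fun c : Fin (n - p) → ℂ => D.rot v₀.1 (WithLp.toLp 2 c)) :=
      (D.rot v₀.1).toContinuousLinearEquiv.contDiff.comp
        (PiLp.continuousLinearEquiv 2 ℂ (fun _ : Fin (n - p) => ℂ)).symm.contDiff
    refine (h1.contMDiff.contMDiffAt.comp v₀ h0.2).congr_of_eventuallyEq ?_
    have hc : ContinuousAt (fun v : TotalSpace (Fin (n - p) → ℂ) (Copies (n - p) D.core.Fiber) =>
      v.1) v₀ := h0.1.continuousAt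
    filter_upwards [hc.preimage_mem_nhds ((D.isOpen_dom v₀.1).mem_nhds (D.mem_dom v₀.1))] with v hv
    exact D.pullCoord_iso hv v.2
  · intro w₀
    rw [contMDiffAt_totalSpace]
    have h0 := contMDiffAt_totalSpace.1 (contMDiffAt_id (I := 𝓘(ℂ, E).prod 𝓘(ℂ, Cn (n - p)))
      (n := ω) (x := w₀))
    refine ⟨h0.1, ?_⟩
    have h1 : ContDiff ℂ ω (fun c : Cn (n - p) => ((D.rot w₀.1).symm c).ofLp) :=
      (PiLp.continuousLinearEquiv 2 ℂ (fun _ : Fin (n - p) => ℂ)).contDiff.comp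
        (D.rot w₀.1).symm.toContinuousLinearEquiv.contDiff
    refine (h1.contMDiff.contMDiffAt.comp w₀ h0.2).congr_of_eventuallyEq ?_
    have hc : ContinuousAt (fun v : TotalSpace (Cn (n - p)) (PullQuot f) => v.1) w₀ :=
      h0.1.continuousAt
    filter_upwards [hc.preimage_mem_nhds ((D.isOpen_dom w₀.1).mem_nhds (D.mem_dom w₀.1))] with w hw
    have h2 := D.pullCoord_iso hw ((D.iso w.1).symm w.2)
    rw [LinearEquiv.apply_symm_apply] at h2
    change _ = ((D.rot w₀.1).symm (pullCoord f w₀.1 w.1 w.2)).ofLp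
    rw [h2, LinearIsometryEquiv.symm_apply_apply]
    rfl
  · intro y v w
    exact D.metric_iso y v w

end ScalarTransitions

end LineBundle

/-! ### Projectively flat maps are strongly projectively flat -/

section FlatToStrong

variable {E : Type*} [NormedAddCommGroup E] [NormedSpace ℂ E]
  {M : Type*} [TopologicalSpace M] [ChartedSpace E M] {p n : ℕ}

lemma coordTrans_self (f : HolMap E M p n) {x y : M} (hy : y ∈ coordDom f x) (c : Cn (n - p)) :
    coordTrans f x x y c = c := by
  obtain ⟨v, rfl⟩ := (f x).quotMap_surjective (f y) c
  exact (congrArg (fun T : Cn n →L[ℂ] Cn (n - p) => T v) (coordMap_eq_coordTrans_comp f hy hy)).symm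

lemma coordTrans_comp (f : HolMap E M p n) {x x' x'' y : M} (hy : y ∈ coordDom f x)
    (hy' : y ∈ coordDom f x') (hy'' : y ∈ coordDom f x'') (c : Cn (n - p)) :
    coordTrans f x' x'' y (coordTrans f x x' y c) = coordTrans f x x'' y c := by
  obtain ⟨v, hv⟩ := (f x).quotMap_surjective (f y) c
  have hv : coordMap f x y v = c := hv
  have h : ∀ {x x' : M}, y ∈ coordDom f x → y ∈ coordDom f x' →
      coordTrans f x x' y (coordMap f x y v) = coordMap f x' y v := fun h1 h2 =>
    (congrArg (fun T : Cn n →L[ℂ] Cn (n - p) => T v) (coordMap_eq_coordTrans_comp f h1 h2)).symm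
  rw [← hv, h hy hy', h hy' hy'', h hy hy'']

/-- In rank zero there is nothing to choose. -/
def ScalarTransitions.ofSubsingleton (f : HolMap E M p n) [Subsingleton (Cn (n - p))] :
    ScalarTransitions f where
  dom := coordDom f
  isOpen_dom := isOpen_coordDom f
  mem_dom := mem_coordDom_self f
  dom_subset _ := subset_rfl
  rot _ := .refl ℂ _
  trans _ _ _ := 1
  coordTrans_rot _ _ _ _ _ _ := Subsingleton.elim _ _
  trans_self _ _ _ := rfl
  trans_comp _ _ _ _ _ _ _ := one_mul 1
  contMDiffOn_trans _ _ := contMDiffOn_const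
  norm _ _ := 1
  norm_self _ := rfl
  norm_trans _ _ _ _ _ := by simp
  contMDiffOn_norm _ := contMDiffOn_const

variable [IsManifold 𝓘(ℂ, E) ω M]

theorem nonempty_scalarTransitions {f : HolMap E M p n} (hf : IsProjectivelyFlat f) :
    Nonempty (ScalarTransitions f) := by
  rcases subsingleton_or_nontrivial (Cn (n - p)) with _ | _
  · exact ⟨.ofSubsingleton f⟩
  obtain ⟨N, a, hNo, hxN, hNd, hK, hc⟩ := exists_scalar_transitions hf
  obtain ⟨e, he⟩ := exists_norm_eq (Cn (n - p)) (zero_le_one)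
  have hee : inner ℂ e e = 1 := by simp [inner_self_eq_norm_sq_to_K, he]
  -- The scalars are matrix coefficients at a unit vector `e`: `μ` of the transition functions,
  -- which are holomorphic, and `κ` of the kernels on the diagonal, which are smooth.
  let μ : M → M → M → ℂ := fun x x' y => inner ℂ (a x' e) (coordTrans f x x' y (a x e))
  let κ : M → M → ℂ := fun x y => inner ℂ e (kernel (coordMap f x) y y e)
  have hμ : ∀ x x' y, y ∈ N x → y ∈ N x' → ∀ w,
      coordTrans f x x' y (a x w) = μ x x' y • a x' w := by
    intro x x' y hy hy' w
    obtain ⟨c, hc⟩ := hc x x' y hy hy'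
    have : μ x x' y = c := by
      change inner ℂ _ _ = c
      rw [hc e, inner_smul_right, LinearIsometryEquiv.inner_map_map, hee, mul_one]
    rw [hc, this]
  have hκ : ∀ x, ∀ y ∈ N x, kernel (coordMap f x) y y = κ x y • 1 := by
    intro x y hy
    obtain ⟨c, hc⟩ := Submodule.mem_span_singleton.1 (hK x y hy)
    have : κ x y = c := by
      change inner ℂ _ _ = c
      rw [← hc, smul_apply, one_apply_eq_self, inner_smul_right, hee, mul_one]
    rw [← hc, this]
  have hκ0 : ∀ x, ∀ y ∈ N x, κ x y ≠ 0 := by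
    intro x y hy h0
    have h1 := hκ x y hy
    rw [h0, zero_smul] at h1
    exact not_isUnit_zero (h1 ▸ isUnit_kernel_coordMap f x y)
  -- From `K' = g K g*` for the transition function `g`.
  have hκμ : ∀ x x' y, y ∈ N x → y ∈ N x' →
      κ x' y = conj (μ x x' y) * μ x x' y * κ x y := by
    intro x x' y hy hy'
    set g := coordTrans f x x' y with hg
    have hadj : (g†) (a x' e) = conj (μ x x' y) • a x e := by
      refine ext_inner_right ℂ fun v => ?_
      obtain ⟨w, rfl⟩ := (a x).surjective v
      rw [adjoint_inner_left, hμ x x' y hy hy', inner_smul_right, inner_smul_left,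
        LinearIsometryEquiv.inner_map_map, LinearIsometryEquiv.inner_map_map, Complex.conj_conj]
    have h1 : inner ℂ (a x' e) (kernel (coordMap f x') y y (a x' e)) = κ x' y := by
      rw [hκ x' y hy', smul_apply, one_apply_eq_self, inner_smul_right,
        LinearIsometryEquiv.inner_map_map, hee, mul_one]
    have h2 : kernel (coordMap f x') y y = κ x y • (g ∘L g†) := by
      rw [kernel, coordMap_eq_coordTrans_comp f (hNd x hy) (hNd x' hy'), adjoint_comp, comp_assoc,
        ← comp_assoc (coordMap f x y)]
      change g ∘L (kernel (coordMap f x) y y ∘L _) = _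
      rw [hκ x y hy, smul_comp, comp_smul]
      rfl
    rw [← h1, h2, smul_apply, comp_apply, inner_smul_right, ← adjoint_inner_left, hadj,
      inner_smul_left, inner_smul_right, LinearIsometryEquiv.inner_map_map, hee, Complex.conj_conj]
    ring
  refine ⟨⟨N, hNo, hxN, hNd, a, μ, hμ, ?_, ?_, ?_, fun x y => (κ x y)⁻¹, ?_, ?_, ?_⟩⟩
  · intro x y hy
    change inner ℂ _ _ = 1
    rw [coordTrans_self f (hNd x hy), LinearIsometryEquiv.inner_map_map, hee]
  · intro x x' x'' y hy hy' hy''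
    have h1 := coordTrans_comp f (hNd x hy) (hNd x' hy') (hNd x'' hy'') (a x e)
    rw [hμ x x' y hy hy', map_smul, hμ x' x'' y hy' hy'', hμ x x'' y hy hy'', smul_smul] at h1
    have h2 := congrArg (fun v => inner ℂ (a x'' e) v) h1
    simp only [inner_smul_right, LinearIsometryEquiv.inner_map_map, hee, mul_one] at h2
    rw [mul_comm, h2]
  · intro x x'
    have h1 : ContDiff ℂ ω (fun T : Cn (n - p) →L[ℂ] Cn (n - p) => inner ℂ (a x' e) (T (a x e))) :=
      (innerSL ℂ (a x' e) ∘L ContinuousLinearMap.apply ℂ _ (a x e)).contDiff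
    exact h1.contMDiff.comp_contMDiffOn
      ((contMDiffOn_coordTrans f x x').mono fun y hy => hNd x' hy.2)
  · intro x
    change (inner ℂ e (kernel (coordMap f x) x x e))⁻¹ = 1
    rw [kernel_coordMap_self, one_apply_eq_self, hee, inv_one]
  · intro x x' y hy hy'
    have h1 := hκμ x x' y hy hy'
    have h2 := hκ0 x y hy
    have h3 := hκ0 x' y hy'
    rw [h1] at h3
    have h4 : conj (μ x x' y) * μ x x' y ≠ 0 := left_ne_zero_of_mul h3
    rw [h1, mul_inv, mul_inv_cancel_left₀ h4]
  · intro x y hy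
    have h1 : ContDiff ℝ ∞ (fun T : Cn n →L[ℂ] Cn (n - p) => inner ℂ e ((T ∘L T†) e)) :=
      ((innerSL ℂ e ∘L ContinuousLinearMap.apply ℂ _ e).restrictScalars ℝ).contDiff.comp
        ((compRCLM (Cn n) (Cn (n - p))).isBoundedBilinearMap.contDiff.comp
          (contDiff_id.prodMk (adjointRCLM (Cn n) (Cn (n - p))).contDiff))
    have h2 : ContMDiffWithinAt 𝓘(ℝ, E) 𝓘(ℝ, ℂ) ∞ (κ x) (N x) y :=
      h1.contMDiff.contMDiffAt.comp_contMDiffWithinAt y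
        (contMDiffWithinAt_real (((contMDiffOn_coordMap f x).mono (hNd x)) y hy))
    exact (contDiffAt_inv ℝ (hκ0 x y hy)).contMDiffAt.comp_contMDiffWithinAt y h2

theorem isStronglyProjectivelyFlat_of_isProjectivelyFlat {f : HolMap E M p n}
    (hf : IsProjectivelyFlat f) : IsStronglyProjectivelyFlat f :=
  (nonempty_scalarTransitions hf).some.isStronglyProjectivelyFlat

end FlatToStrong

/-! ### Sums of copies of a line bundle are projectively flat -/

section WirtingerRules

variable {E : Type*} [NormedAddCommGroup E] [NormedSpace ℂ E] {z : E}

lemma del_mul {f g : E → ℂ} (hf : DifferentiableAt ℝ f z) (hg : DifferentiableAt ℝ g z) (v : E) :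
    del (fun w => f w * g w) z v = del f z v * g z + f z * del g z v := by
  have h : ∀ u, fderiv ℝ (fun w => f w * g w) z u = f z * fderiv ℝ g z u + g z * fderiv ℝ f z u :=
    fun u => by
      rw [fderiv_fun_mul hf hg]
      rfl
  simp only [del, h]
  ring

lemma del_sum {ι : Type*} {s : Finset ι} {f : ι → E → ℂ}
    (hf : ∀ i ∈ s, DifferentiableAt ℝ (f i) z) (v : E) :
    del (fun w => ∑ i ∈ s, f i w) z v = ∑ i ∈ s, del (f i) z v := by
  simp only [del, fderiv_fun_sum hf, sum_apply, Finset.mul_sum, ← Finset.sum_sub_distrib,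
    Finset.sum_div]

lemma delbar_add {f g : E → ℂ} (hf : DifferentiableAt ℝ f z) (hg : DifferentiableAt ℝ g z)
    (v : E) : delbar (fun w => f w + g w) z v = delbar f z v + delbar g z v := by
  simp only [delbar, fderiv_fun_add hf hg, add_apply]
  ring

lemma delbar_mul_const {f : E → ℂ} (hf : DifferentiableAt ℝ f z) (c : ℂ) (v : E) :
    delbar (fun w => f w * c) z v = delbar f z v * c := by
  have h : ∀ u, fderiv ℝ (fun w => f w * c) z u = c * fderiv ℝ f z u := fun u => by
    rw [fderiv_mul_const hf]
    rfl
  simp only [delbar, h]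
  ring

lemma fderiv_real_apply {f : E → ℂ} (hf : DifferentiableAt ℂ f z) (v : E) :
    fderiv ℝ f z v = fderiv ℂ f z v := by
  rw [(hf.hasFDerivAt.restrictScalars ℝ).fderiv]
  rfl

lemma del_of_differentiableAt {f : E → ℂ} (hf : DifferentiableAt ℂ f z) (v : E) :
    del f z v = fderiv ℂ f z v := by
  rw [del, fderiv_real_apply hf, fderiv_real_apply hf, map_smul, smul_eq_mul]
  linear_combination (-(fderiv ℂ f z v) / 2) * Complex.I_mul_I

lemma delbar_of_differentiableAt {f : E → ℂ} (hf : DifferentiableAt ℂ f z) (v : E) :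
    delbar f z v = 0 := by
  rw [delbar, fderiv_real_apply hf, fderiv_real_apply hf, map_smul, smul_eq_mul]
  linear_combination ((fderiv ℂ f z v) / 2) * Complex.I_mul_I

lemma hasFDerivAt_conj {f : E → ℂ} (hf : DifferentiableAt ℂ f z) :
    HasFDerivAt (fun w => conj (f w))
      ((Complex.conjCLE : ℂ →L[ℝ] ℂ) ∘L (fderiv ℂ f z).restrictScalars ℝ) z :=
  Complex.conjCLE.hasFDerivAt.comp z (hf.hasFDerivAt.restrictScalars ℝ)

lemma del_conj_of_differentiableAt {f : E → ℂ} (hf : DifferentiableAt ℂ f z) (v : E) :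
    del (fun w => conj (f w)) z v = 0 := by
  rw [del, (hasFDerivAt_conj hf).fderiv]
  simp only [comp_apply, coe_restrictScalars', map_smul, smul_eq_mul,
    ContinuousLinearEquiv.coe_coe, Complex.conjCLE_apply, map_mul, Complex.conj_I]
  linear_combination (conj (fderiv ℂ f z v) / 2) * Complex.I_mul_I

lemma differentiableAt_del {f : E → ℂ} (hf : ContDiffAt ℝ 2 f z) (v : E) :
    DifferentiableAt ℝ (fun w => del f w v) z := by
  have h1 : ∀ u, DifferentiableAt ℝ (fun w => fderiv ℝ f w u) z := fun u =>
    ((hf.fderiv_right (m := 1) (by norm_num)).differentiableAt (by norm_num)).clm_apply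
      (differentiableAt_const u)
  simp only [del, div_eq_mul_inv]
  exact ((h1 v).fun_sub ((h1 (Complex.I • v)).const_mul Complex.I)).mul_const _

end WirtingerRules

section MatrixDeriv

variable {E : Type*} [NormedAddCommGroup E] [NormedSpace ℂ E] {z : E} {r : ℕ}

lemma differentiableAt_det {A : E → Matrix (Fin r) (Fin r) ℂ}
    (hA : ∀ i j, DifferentiableAt ℂ (fun w => A w i j) z) :
    DifferentiableAt ℂ (fun w => (A w).det) z := by
  simp only [Matrix.det_apply]
  exact DifferentiableAt.fun_sum fun σ _ =>
    (HasFDerivAt.finsetProd fun i _ => (hA (σ i) i).hasFDerivAt).differentiableAt.const_smul _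

lemma differentiableAt_matrix_inv {A : E → Matrix (Fin r) (Fin r) ℂ}
    (hA : ∀ i j, DifferentiableAt ℂ (fun w => A w i j) z) (h0 : (A z).det ≠ 0) (i j : Fin r) :
    DifferentiableAt ℂ (fun w => (A w)⁻¹ i j) z := by
  simp only [Matrix.inv_def, Matrix.smul_apply, smul_eq_mul, Ring.inverse_eq_inv']
  refine ((differentiableAt_det hA).inv h0).mul ?_
  simp only [Matrix.adjugate_apply]
  refine differentiableAt_det fun i' j' => ?_
  simp only [Matrix.updateRow_apply]
  split_ifs
  · exact differentiableAt_const _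
  · exact hA _ _

/-- The curvature of the line bundle with metric `ρ` in a holomorphic frame. -/
def lineCurvature (ρ : E → ℂ) (z u v : E) : ℂ :=
  delbar (fun w => del ρ w v / ρ w) z u - delbar (fun w => del ρ w u / ρ w) z v

open Matrix in
/-- For the Gram matrix `ρ A* A` with `A` holomorphic, the connection form is
`∂ρ / ρ + A⁻¹ ∂A`. -/
lemma connectionForm_of_eq_smul {H A : E → Matrix (Fin r) (Fin r) ℂ} {ρ : E → ℂ}
    (hH : H =ᶠ[𝓝 z] fun w => ρ w • ((A w)ᴴ * A w))
    (hA : ∀ i j, DifferentiableAt ℂ (fun w => A w i j) z) (hρ : DifferentiableAt ℝ ρ z)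
    (hA0 : (A z).det ≠ 0) (hρ0 : ρ z ≠ 0) (v : E) :
    connectionForm H z v = (del ρ z v / ρ z) • 1 +
      (A z)⁻¹ * Matrix.of fun i j => fderiv ℂ (fun w => A w i j) z v := by
  set A' : Matrix (Fin r) (Fin r) ℂ := Matrix.of fun i j => fderiv ℂ (fun w => A w i j) z v
    with hA'
  have hdet : IsUnit (A z).det := isUnit_iff_ne_zero.2 hA0
  have h1 : (Matrix.of fun i j => del (fun w => H w i j) z v) =
      del ρ z v • ((A z)ᴴ * A z) + ρ z • ((A z)ᴴ * A') := by
    ext i j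
    have hev : (fun w => H w i j) =ᶠ[𝓝 z]
        fun w => ρ w * ∑ k, conj (A w k i) * A w k j := by
      filter_upwards [hH] with w hw
      rw [hw]
      rfl
    have hr : ∀ k j, DifferentiableAt ℝ (fun w => A w k j) z := fun k j =>
      (hA k j).restrictScalars ℝ
    have hc : ∀ k i, DifferentiableAt ℝ (fun w => conj (A w k i)) z := fun k i =>
      (hasFDerivAt_conj (hA k i)).differentiableAt
    rw [Matrix.of_apply, hev.del_eq,
      del_mul hρ (DifferentiableAt.fun_sum fun k _ => (hc k i).fun_mul (hr k j)),
      del_sum (fun k _ => (hc k i).fun_mul (hr k j))]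
    simp only [del_mul (hc _ i) (hr _ j), del_conj_of_differentiableAt (hA _ i),
      del_of_differentiableAt (hA _ j), zero_mul, zero_add]
    rfl
  have h2 : (Matrix.of fun i j => del (fun w => H w i j) z v) =
      H z * ((del ρ z v / ρ z) • 1 + (A z)⁻¹ * A') := by
    rw [h1, hH.eq_of_nhds, mul_add, smul_mul_assoc, mul_smul_comm, mul_one, smul_smul,
      mul_div_cancel₀ _ hρ0, smul_mul_assoc, mul_assoc, Matrix.mul_nonsing_inv_cancel_left _ _ hdet]
  have h3 : IsUnit (H z).det := by
    rw [hH.eq_of_nhds, Matrix.det_smul, Matrix.det_mul, Matrix.det_conjTranspose]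
    simp [hA0, hρ0]
  rw [connectionForm, h2, Matrix.nonsing_inv_mul_cancel_left _ _ h3]

/-- In any holomorphic frame of a sum of copies of a line bundle, the curvature is scalar. Here
`A` holds the coefficients of the frame and `ρ` is the metric of the line bundle. -/
theorem curvatureForm_of_eq_smul {H A : E → Matrix (Fin r) (Fin r) ℂ} {ρ : E → ℂ}
    (hH : H =ᶠ[𝓝 z] fun w => ρ w • (Matrix.conjTranspose (A w) * A w))
    (hA : ∀ i j, AnalyticAt ℂ (fun w => A w i j) z) (hρ : ContDiffAt ℝ 2 ρ z)
    (hA0 : (A z).det ≠ 0) (hρ0 : ρ z ≠ 0) (u v : E) :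
    curvatureForm H z u v = lineCurvature ρ z u v • 1 := by
  have hAd : ∀ i j, DifferentiableAt ℂ (fun w => A w i j) z := fun i j => (hA i j).differentiableAt
  have key : ∀ u v i j, delbar (fun w => connectionForm H w v i j) z u =
      delbar (fun w => del ρ w v / ρ w) z u * (1 : Matrix (Fin r) (Fin r) ℂ) i j := by
    intro u v i j
    -- The holomorphic part of the connection form, which `∂̄` kills.
    have hB : DifferentiableAt ℂ (fun w => ((A w)⁻¹ *
        Matrix.of fun i j => fderiv ℂ (fun w => A w i j) w v) i j) z := by
      simp only [Matrix.mul_apply, Matrix.of_apply]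
      exact DifferentiableAt.fun_sum fun k _ => (differentiableAt_matrix_inv hAd hA0 i k).mul
        ((hA k j).fderiv.differentiableAt.clm_apply (differentiableAt_const v))
    have hev : (fun w => connectionForm H w v i j) =ᶠ[𝓝 z] fun w =>
        del ρ w v / ρ w * (1 : Matrix (Fin r) (Fin r) ℂ) i j +
        ((A w)⁻¹ * Matrix.of fun i j => fderiv ℂ (fun w => A w i j) w v) i j := by
      filter_upwards [hH.eventually_nhds,
        Filter.eventually_all.2 fun i => Filter.eventually_all.2 fun j =>
          (hA i j).eventually_analyticAt,
        hρ.eventually (by norm_num), (differentiableAt_det hAd).continuousAt.eventually_ne hA0,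
        hρ.continuousAt.eventually_ne hρ0] with w h1 h2 h3 h4 h5
      rw [connectionForm_of_eq_smul h1 (fun i j => (h2 i j).differentiableAt)
        (h3.differentiableAt (by norm_num)) h4 h5]
      rfl
    have hd : DifferentiableAt ℝ (fun w => del ρ w v / ρ w) z := by
      simp only [div_eq_mul_inv]
      exact (differentiableAt_del hρ v).fun_mul ((hρ.differentiableAt (by norm_num)).inv hρ0)
    rw [hev.delbar_eq, delbar_add (hd.mul_const _) (hB.restrictScalars ℝ), delbar_mul_const hd,
      delbar_of_differentiableAt hB, add_zero]
  ext i j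
  rw [curvatureForm, Matrix.of_apply, key, key, ← sub_mul]
  rfl

end MatrixDeriv

section StrongToFlat

variable {E : Type*} [NormedAddCommGroup E] [NormedSpace ℂ E]
  {M : Type*} [TopologicalSpace M] [ChartedSpace E M] {p n : ℕ}

/-- The square norm of the frame of a Hermitian line bundle given by its trivialization at `x`. -/
def HermitianLineBundle.frameNorm (L : HermitianLineBundle E M) (x y : M) : ℂ :=
  L.metric y ((trivializationAt ℂ L.Fib x).symm y 1) ((trivializationAt ℂ L.Fib x).symm y 1)

lemma IsHermitianMetric.smul_smul {F : Type*} [NormedAddCommGroup F] [NormedSpace ℂ F]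
    {V : M → Type*} [∀ x, AddCommGroup (V x)] [∀ x, Module ℂ (V x)]
    [∀ x, TopologicalSpace (V x)] [TopologicalSpace (TotalSpace F V)] [FiberBundle F V]
    {h : ∀ x, V x → V x → ℂ} (hh : IsHermitianMetric (E := E) F V h) {x : M} (a b : ℂ) (v w : V x) :
    h x (a • v) (b • w) = conj a * b * h x v w := by
  rw [hh.smul_right, ← hh.conj_symm, hh.smul_right, map_mul, hh.conj_symm]
  ring

namespace HermitianLineBundle

variable (L : HermitianLineBundle E M)

lemma metric_eq_frameNorm {x y : M} (hy : y ∈ (trivializationAt ℂ L.Fib x).baseSet)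
    (v w : L.Fib y) : L.metric y v w = conj (trivializationAt ℂ L.Fib x ⟨y, v⟩).2 *
      (trivializationAt ℂ L.Fib x ⟨y, w⟩).2 * L.frameNorm x y := by
  have h : ∀ v : L.Fib y, v = (trivializationAt ℂ L.Fib x ⟨y, v⟩).2 •
      (trivializationAt ℂ L.Fib x).symm y 1 := by
    intro v
    set e := trivializationAt ℂ L.Fib x
    have h1 := e.symmₗ_linearMapAt (R := ℂ) hy v
    have h2 : e.linearMapAt ℂ y v = (e ⟨y, v⟩).2 • (1 : ℂ) := by
      rw [e.linearMapAt_apply (R := ℂ), if_pos hy, smul_eq_mul, mul_one]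
    rw [h2, map_smul, e.coe_symmₗ (R := ℂ) hy] at h1
    exact h1.symm
  conv_lhs => rw [h v, h w]
  rw [L.isHermitianMetric.smul_smul, frameNorm]

lemma frameNorm_self_ne_zero (x : M) : L.frameNorm x x ≠ 0 := by
  have hx := mem_baseSet_trivializationAt ℂ L.Fib x
  have h1 := L.isHermitianMetric.pos x ((trivializationAt ℂ L.Fib x).symm x 1) (by
    intro h0
    have h2 := (trivializationAt ℂ L.Fib x).apply_mk_symm hx (1 : ℂ)
    rw [h0] at h2
    have h3 := ((trivializationAt ℂ L.Fib x).linearMapAt ℂ x).map_zero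
    rw [(trivializationAt ℂ L.Fib x).linearMapAt_apply (R := ℂ), if_pos hx, h2] at h3
    exact one_ne_zero h3)
  intro h0
  rw [frameNorm] at h0
  rw [h0] at h1
  simp at h1

lemma contMDiffAt_frameNorm (x : M) : ContMDiffAt 𝓘(ℝ, E) 𝓘(ℝ, ℂ) ∞ (L.frameNorm x) x := by
  set e := trivializationAt ℂ L.Fib x
  have hs : IsHolomorphicOn (E := E) ℂ L.Fib (fun y => e.symm y 1) e.baseSet := by
    refine e.contMDiffOn_section_baseSet_iff.2 ((contMDiffOn_const (c := (1 : ℂ))).congr ?_)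
    intro y hy
    rw [e.apply_mk_symm hy]
  exact (L.isHermitianMetric.smooth _ _ _ e.open_baseSet hs hs).contMDiffAt
    (e.open_baseSet.mem_nhds (mem_baseSet_trivializationAt ℂ L.Fib x))

end HermitianLineBundle

/-- A sum of copies of a line bundle `L` is projectively flat, with `α` the curvature of `L`. -/
theorem isProjectivelyFlat_of_isStronglyProjectivelyFlat {f : HolMap E M p n}
    (hf : IsStronglyProjectivelyFlat f) : IsProjectivelyFlat f := by
  obtain ⟨L, φ, -, hφ', hmet⟩ := hf
  refine ⟨fun x u v => lineCurvature (fun z => L.frameNorm x ((extChartAt 𝓘(ℂ, E) x).symm z))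
    (extChartAt 𝓘(ℂ, E) x x) u v, fun U s hU hs x hx u v => ?_⟩
  set e := trivializationAt ℂ L.Fib x with he
  have hxe : x ∈ e.baseSet := mem_baseSet_trivializationAt ℂ L.Fib x
  set ψ := extChartAt 𝓘(ℂ, E) x with hψ
  have hψx : ψ.symm (ψ x) = x := extChartAt_to_inv x
  let ι : Fin (Module.finrank ℂ (Cn (n - p))) ≃ Fin (n - p) := finCongr (finrank_euclideanSpace_fin)
  -- the coefficients of the frame `s` in the frame of the sum of copies of `L`
  let a (y : M) : Matrix (Fin (Module.finrank ℂ (Cn (n - p))))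
      (Fin (Module.finrank ℂ (Cn (n - p)))) ℂ :=
     Matrix.of fun k j => (e ⟨y, (φ y).symm (s j y) (ι k)⟩).2
  refine curvatureForm_of_eq_smul (A := fun z => a (ψ.symm z)) ?_ ?_ ?_ ?_ ?_ u v
  · have hc : ContinuousAt ψ.symm (ψ x) := continuousAt_extChartAt_symm x
    filter_upwards [hc.preimage_mem_nhds (e.open_baseSet.mem_nhds (by rwa [hψx]))] with z hz
    ext i j
    set y := ψ.symm z
    have h1 := hmet y ((φ y).symm (s i y)) ((φ y).symm (s j y))
    rw [LinearEquiv.apply_symm_apply, LinearEquiv.apply_symm_apply] at h1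
    rw [Matrix.of_apply, h1, copiesMetric, ← ι.sum_comp]
    refine (Finset.sum_congr rfl fun k _ => L.metric_eq_frameNorm hz _ _).trans ?_
    rw [← Finset.sum_mul, mul_comm]
    rfl
  · intro k j
    have h1 : ContMDiffAt 𝓘(ℂ, E) (𝓘(ℂ, E).prod 𝓘(ℂ, Fin (n - p) → ℂ)) ω
        (fun y => TotalSpace.mk' (Fin (n - p) → ℂ) (E := Copies (n - p) L.Fib) y
          ((φ y).symm (s j y))) x :=
      hφ'.contMDiffAt.comp x ((hs.contMDiffOn j).contMDiffAt (hU.mem_nhds hx))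
    have h2 := (contMDiffAt_section x).1 h1
    rw [contMDiffAt_iff] at h2
    have h3 := (contDiffAt_pi.1 ((contDiffWithinAt_univ).1 (by simpa using! h2.2)) (ι k)).analyticAt
    refine h3.congr ?_
    have hc : ContinuousAt ψ.symm (ψ x) := continuousAt_extChartAt_symm x
    filter_upwards [hc.preimage_mem_nhds (e.open_baseSet.mem_nhds (by rwa [hψx]))] with z hz
    exact trivializationAt_copies_apply (V := L.Fib) (n - p) hz _ (ι k)
  · have h1 := (contMDiffAt_iff.1 (L.contMDiffAt_frameNorm x)).2
    have h2 := contDiffWithinAt_univ.1 (by simpa using! h1)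
    exact h2.of_le (WithTop.coe_le_coe.2 le_top)
  -- A vector in the kernel of the coefficient matrix is a linear relation in the frame `s`.
  · change (a (ψ.symm (ψ x))).det ≠ 0
    rw [hψx]
    intro h0
    obtain ⟨t, ht0, ht⟩ := Matrix.exists_mulVec_eq_zero_iff.2 h0
    apply ht0
    have hli := Fintype.linearIndependent_iff.1 (hs.linearIndependent hx) t
    refine funext (hli ?_)
    have h1 : ∑ j, t j • (φ x).symm (s j x) = 0 := by
      refine funext fun k => ?_
      obtain ⟨k, rfl⟩ := ι.surjective k
      have h2 := congrFun ht k
      let w : ∀ j, L.Fib x := fun j => (φ x).symm (s j x) (ι k)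
      have h3 : (∑ j, t j • (φ x).symm (s j x)) (ι k) = ∑ j, t j • w j := Finset.sum_apply _ _ _
      suffices h4 : ∑ j, t j • w j = 0 from h3.trans h4
      apply (e.continuousLinearEquivAt ℂ x hxe).injective
      rw [map_zero, map_sum]
      simp only [map_smul]
      refine Eq.trans (Finset.sum_congr rfl fun j _ => ?_) h2
      exact mul_comm _ _
    have h2 := congrArg (φ x) h1
    simpa using h2
  · change L.frameNorm x (ψ.symm (ψ x)) ≠ 0
    rw [hψx]
    exact L.frameNorm_self_ne_zero x

end StrongToFlat

end ProjFlat

end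

theorem proposition1 {E : Type*} [NormedAddCommGroup E] [NormedSpace ℂ E] [FiniteDimensional ℂ E]
    {M : Type*} [TopologicalSpace M] [ChartedSpace E M] [IsManifold 𝓘(ℂ, E) ω M]
    [CompactSpace M] [T2Space M]
    (g : ∀ x : M, TangentSpace 𝓘(ℂ, E) x → TangentSpace 𝓘(ℂ, E) x → ℂ) (hg : IsKahlerMetric g)
    {p n : ℕ} (f : HolMap E M p n) (hf : IsIsometricMap g f) :
    IsStronglyProjectivelyFlat f ↔ IsProjectivelyFlat f :=
  ⟨isProjectivelyFlat_of_isStronglyProjectivelyFlat,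
    isStronglyProjectivelyFlat_of_isProjectivelyFlat⟩
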